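/- Let $k$ be a field, let $Q$ be a finite connected quiver with no oriented cycles (i.e. $Q$ is triangular), let $kQ$ be its path algebra (paths are composed from left to right, $e_x$ is the stationary path at $x$) and let $F$ be the two-sided ideal generated by the arrows. Let $I$ be an admissible ideal of $kQ$, i.e. a two-sided ideal with $F^m\subseteq I\subseteq F^2$ for some $m\ge 2$, so that $(Q,I)$ is a bound quiver. A *minimal relation* is an element $\sum_{i=1}^m\lambda_iw_i\in I$ with $m\ge2$, $\lambda_i\in k\setminus\{0\}$ and $w_1,\dots,w_m$ distinct paths with the same source and the same target, such that $\sum_{i\in J}\lambda_iw_i\notin I$ for every nonempty proper subset $J\subset\{1,\dots,m\}$. *Homotopy* $\sim$ is the smallest equivalence relation on walks in $Q$ such that $\alpha\alpha^{-1}\sim e_x$ and $\alpha^{-1}\alpha\sim e_y$ for each arrow $\alpha:x\to y$, such that $w_i\sim w_j$ whenever $w_i,w_j$ appear in the same minimal relation, and such that $u\sim v$ implies $wuw'\sim wvw'$ whenever these compositions are defined. *Natural homotopy* is the smallest equivalence relation on paths which identifies any two paths appearing in the same minimal relation and which is stable under composition with paths on both sides; the class of a path $\sigma$ is written $\tilde\sigma$.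 For a vertex $x_0$, let $\pi_1(Q,x_0)$ be the fundamental group of the underlying graph of $Q$, and let $N(Q,I,x_0)$ be its normal subgroup generated by the classes of the closed walks that run along a walk $w$ from $x_0$ to a vertex $x$, then along a path $v$ from $x$ to a vertex $y$, then back along a path $u$ from $x$ to $y$ with $u\sim v$, and finally back along $w$. Put $\pi_1(Q,I)=\pi_1(Q,x_0)/N(Q,I,x_0)$. Let $\mathcal C_0$ be the set of vertices of $Q$ and, for $n\ge1$, let $\mathcal C_n$ be the set of tuples $(\tilde\sigma_1,\dots,\tilde\sigma_n)$ having representatives $\sigma_1,\dots,\sigma_n$ that are non-stationary paths whose composite $\sigma_1\cdots\sigma_n$ is defined and not in $I$. The face maps $\partial_0,\dots,\partial_n:\mathcal C_n\to\mathcal C_{n-1}$ are: for $n\ge 2$, $\partial_0$ and $\partial_n$ delete $\tilde\sigma_1$ and $\tilde\sigma_n$ respectively, and $\partial_i$ with $0<i<n$ replaces $\tilde\sigma_i,\tilde\sigma_{i+1}$ by the class of $\sigma_i\sigma_{i+1}$; for $n=1$ and $\sigma$ a path from $x$ to $y$, $\partial_0\tilde\sigma=y$ and $\partial_1\tilde\sigma=x$.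 The classifying space $\mathcal B=\mathcal B(Q,I)$ is the CW-complex obtained by attaching one standard $n$-simplex for each element of $\mathcal C_n$, $n\ge0$, along its faces: it is the quotient of the disjoint union of these simplices in which, for each $n\ge1$, $c\in\mathcal C_n$ and $0\le i\le n$, the $i$-th face $\{t_i=0\}$ of the simplex of $c$ is identified with the simplex of $\partial_ic$ by the affine bijection preserving the order of the vertices. Then for every vertex $x_0$ of $Q$ and every base point $b\in\mathcal B$, the groups $\pi_1(\mathcal B,b)$ and $\pi_1(Q,I)$ (formed at $x_0$) are isomorphic. -/

import Mathlib

open CategoryTheory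

universe u v w

noncomputable section

/-! ### The path algebra of a finite quiver -/

/-- The path algebra `kQ`: the `k`-vector space with basis all the paths of `Q`, including a
stationary path at each vertex. -/
def PathAlgebra (k : Type w) (Q : Type u) [Field k] [Quiver.{v} Q] : Type (max u v w) :=
  (Σ x : Q, Σ y : Q, Quiver.Path x y) →₀ k

namespace PathAlgebra

variable {k : Type w} {Q : Type u} [Field k] [Quiver.{v} Q]

instance : AddCommGroup (PathAlgebra k Q) :=
  inferInstanceAs (AddCommGroup ((Σ x : Q, Σ y : Q, Quiver.Path x y) →₀ k))

instance : Module k (PathAlgebra k Q) :=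
  inferInstanceAs (Module k ((Σ x : Q, Σ y : Q, Quiver.Path x y) →₀ k))

variable (k Q) in
/-- The basis of `kQ` consisting of all the paths of `Q`. -/
def basis : Module.Basis (Σ x : Q, Σ y : Q, Quiver.Path x y) k (PathAlgebra k Q) :=
  Module.Basis.ofRepr (LinearEquiv.refl k _)

variable (k) in
/-- The basis vector of `kQ` given by a path. -/
def ofPath {x y : Q} (p : Quiver.Path x y) : PathAlgebra k Q :=
  basis k Q ⟨x, y, p⟩

open Classical in
/-- The product of two basis vectors: the composite path if the paths can be composed, and `0`
otherwise. Composition is written from left to right. -/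
def basisMul (p q : Σ x : Q, Σ y : Q, Quiver.Path x y) : PathAlgebra k Q :=
  if h : p.2.1 = q.1 then ofPath k (p.2.2.comp (q.2.2.cast h.symm rfl)) else 0

/-- The multiplication of `kQ`, as a bilinear map. -/
def mulMap : PathAlgebra k Q →ₗ[k] PathAlgebra k Q →ₗ[k] PathAlgebra k Q :=
  (basis k Q).constr k fun p => (basis k Q).constr k fun q => basisMul p q

instance : Mul (PathAlgebra k Q) := ⟨fun a b => mulMap a b⟩

/-- The unit of `kQ` is the sum of all stationary paths. -/
instance [Fintype Q] : One (PathAlgebra k Q) :=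
  ⟨∑ x : Q, ofPath k (Quiver.Path.nil : Quiver.Path x x)⟩

theorem mul_def (a b : PathAlgebra k Q) : a * b = mulMap a b := rfl

theorem one_def [Fintype Q] :
    (1 : PathAlgebra k Q) = ∑ x : Q, ofPath k (Quiver.Path.nil : Quiver.Path x x) := rfl

theorem mulMap_ofPath {a b c d : Q} (p : Quiver.Path a b) (q : Quiver.Path c d) :
    mulMap (ofPath k p) (ofPath k q) = basisMul (k := k) ⟨a, b, p⟩ ⟨c, d, q⟩ := by
  simp [mulMap, ofPath]

theorem ofPath_mul_ofPath {a b c : Q} (p : Quiver.Path a b) (q : Quiver.Path b c) :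
    ofPath k p * ofPath k q = ofPath k (p.comp q) := by
  rw [mul_def, mulMap_ofPath]; simp [basisMul]

theorem ofPath_mul_ofPath_of_ne {a b c d : Q} (p : Quiver.Path a b) (q : Quiver.Path c d)
    (h : b ≠ c) : ofPath k p * ofPath k q = 0 := by
  rw [mul_def, mulMap_ofPath]; simp [basisMul, h]

/-- A property of elements of `kQ` can be checked on multiples of paths and on sums. -/
theorem induction {P : PathAlgebra k Q → Prop} (zero : P 0)
    (add : ∀ a b, P a → P b → P (a + b))
    (path : ∀ (c : k) {x y : Q} (p : Quiver.Path x y), P (c • ofPath k p)) (a : PathAlgebra k Q) :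
    P a := by
  rw [← (basis k Q).linearCombination_repr a]
  induction (basis k Q).repr a using Finsupp.induction_linear with
  | zero => rw [map_zero]; exact zero
  | add f g hf hg => rw [map_add]; exact add _ _ hf hg
  | single p c => rw [Finsupp.linearCombination_single]; exact path c p.2.2

instance : NonUnitalNonAssocRing (PathAlgebra k Q) where
  left_distrib a b c := (mulMap a).map_add b c
  right_distrib a b c := LinearMap.map_add₂ mulMap a b c
  zero_mul a := LinearMap.map_zero₂ mulMap a
  mul_zero a := (mulMap a).map_zero

theorem smul_mul (c : k) (a b : PathAlgebra k Q) : c • a * b = c • (a * b) :=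
  LinearMap.map_smul₂ mulMap c a b

theorem mul_smul (c : k) (a b : PathAlgebra k Q) : a * c • b = c • (a * b) :=
  (mulMap a).map_smul c b

theorem ofPath_assoc {a b c d e f : Q} (p : Quiver.Path a b) (q : Quiver.Path c d)
    (r : Quiver.Path e f) :
    ofPath k p * ofPath k q * ofPath k r = ofPath k p * (ofPath k q * ofPath k r) := by
  by_cases h : b = c
  · subst h
    by_cases h' : d = e
    · subst h'
      simp only [ofPath_mul_ofPath, Quiver.Path.comp_assoc]
    · rw [ofPath_mul_ofPath, ofPath_mul_ofPath_of_ne _ _ h', ofPath_mul_ofPath_of_ne _ _ h',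
        mul_zero]
  · rw [ofPath_mul_ofPath_of_ne _ _ h, zero_mul]
    by_cases h' : d = e
    · subst h'
      rw [ofPath_mul_ofPath, ofPath_mul_ofPath_of_ne _ _ h]
    · rw [ofPath_mul_ofPath_of_ne _ _ h', mul_zero]

protected theorem mul_assoc (a b c : PathAlgebra k Q) : a * b * c = a * (b * c) := by
  induction a using induction with
  | zero => simp only [zero_mul]
  | add a a' h h' => simp only [add_mul, h, h']
  | path x p =>
    induction b using induction with
    | zero => simp only [zero_mul, mul_zero]
    | add b b' h h' => simp only [add_mul, mul_add, h, h']
    | path y q =>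
      induction c using induction with
      | zero => simp only [mul_zero]
      | add c c' h h' => simp only [mul_add, h, h']
      | path z r => simp only [smul_mul, mul_smul, ofPath_assoc]

variable [Fintype Q]

protected theorem one_mul (a : PathAlgebra k Q) : 1 * a = a := by
  induction a using induction with
  | zero => exact mul_zero _
  | add a a' h h' => rw [mul_add, h, h']
  | @path x a b p =>
    rw [mul_smul, one_def, Finset.sum_mul, Finset.sum_eq_single a, ofPath_mul_ofPath,
      Quiver.Path.nil_comp]
    · intro c _ hc
      exact ofPath_mul_ofPath_of_ne _ _ hc
    · simp

protected theorem mul_one (a : PathAlgebra k Q) : a * 1 = a := by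
  induction a using induction with
  | zero => exact zero_mul _
  | add a a' h h' => rw [add_mul, h, h']
  | @path x a b p =>
    rw [smul_mul, one_def, Finset.mul_sum, Finset.sum_eq_single b, ofPath_mul_ofPath,
      Quiver.Path.comp_nil]
    · intro c _ hc
      exact ofPath_mul_ofPath_of_ne _ _ (Ne.symm hc)
    · simp

instance : Ring (PathAlgebra k Q) where
  __ := (inferInstance : NonUnitalNonAssocRing (PathAlgebra k Q))
  mul_assoc := PathAlgebra.mul_assoc
  one_mul := PathAlgebra.one_mul
  mul_one := PathAlgebra.mul_one

instance : Algebra k (PathAlgebra k Q) := Algebra.ofModule smul_mul (fun c a b => mul_smul c a b)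

end PathAlgebra

/-! ### Bound quivers and minimal relations -/

section BoundQuiver

variable {k : Type w} {Q : Type u} [Field k] [Quiver.{v} Q]

variable (k Q) in
/-- The two-sided ideal `F` of `kQ` generated by the arrows. -/
def arrowIdeal : TwoSidedIdeal (PathAlgebra k Q) :=
  TwoSidedIdeal.span {a | ∃ (x y : Q) (α : x ⟶ y), a = PathAlgebra.ofPath k α.toPath}

/-- A two-sided ideal `I` of `kQ` is admissible if `F ^ m ⊆ I ⊆ F ^ 2` for some `m ≥ 2`. A quiver
with an admissible ideal is a bound quiver. -/
def IsAdmissible [Fintype Q] (I : TwoSidedIdeal (PathAlgebra k Q)) : Prop :=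
  ∃ m : ℕ, 2 ≤ m ∧ (arrowIdeal k Q).asIdeal ^ m ≤ I.asIdeal ∧
    I.asIdeal ≤ (arrowIdeal k Q).asIdeal ^ 2

/-- A family of coefficients `r`, supported on paths `w₁, …, wₘ` from `x` to `y`, is a minimal
relation if `∑ r(wᵢ) wᵢ` lies in `I`, `m ≥ 2`, and no sum over a nonempty proper subset of
`{w₁, …, wₘ}` lies in `I`. -/
def IsMinimalRelation (I : TwoSidedIdeal (PathAlgebra k Q)) {x y : Q}
    (r : Quiver.Path x y →₀ k) : Prop :=
  (∑ p ∈ r.support, r p • PathAlgebra.ofPath k p) ∈ I ∧ 2 ≤ r.support.card ∧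
    ∀ J : Finset (Quiver.Path x y), J ⊂ r.support → J.Nonempty →
      (∑ p ∈ J, r p • PathAlgebra.ofPath k p) ∉ I

/-- Two parallel paths appear in the same minimal relation. -/
def InMinimalRelation (I : TwoSidedIdeal (PathAlgebra k Q)) {x y : Q}
    (p q : Quiver.Path x y) : Prop :=
  ∃ r : Quiver.Path x y →₀ k, IsMinimalRelation I r ∧ p ∈ r.support ∧ q ∈ r.support

/-! ### The combinatorial fundamental group -/

/-- Walks in `Q`: paths in the quiver obtained by adding a formal inverse to each arrow. -/
abbrev Walk (x y : Q) : Type (max u v) :=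
  @Quiver.Path (Quiver.Symmetrify Q) _ x y

/-- A path, viewed as a walk. -/
def Walk.ofPath {x y : Q} (p : Quiver.Path x y) : Walk x y :=
  (Quiver.Symmetrify.of (V := Q)).mapPath p

/-- The homotopy relation on walks induced by `I`. -/
inductive Homotopic (I : TwoSidedIdeal (PathAlgebra k Q)) : ∀ {x y : Q}, Walk x y → Walk x y → Prop
  | refl {x y : Q} (p : Walk x y) : Homotopic I p p
  | symm {x y : Q} {p q : Walk x y} : Homotopic I p q → Homotopic I q p
  | trans {x y : Q} {p q r : Walk x y} : Homotopic I p q → Homotopic I q r → Homotopic I p r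
  | arrow_inv {x y : Q} (α : x ⟶ y) :
      Homotopic I ((Walk.ofPath α.toPath).comp (Walk.ofPath α.toPath).reverse)
        (Quiver.Path.nil : Walk x x)
  | inv_arrow {x y : Q} (α : x ⟶ y) :
      Homotopic I ((Walk.ofPath α.toPath).reverse.comp (Walk.ofPath α.toPath))
        (Quiver.Path.nil : Walk y y)
  | minimal {x y : Q} {p q : Quiver.Path x y} : InMinimalRelation I p q →
      Homotopic I (Walk.ofPath p) (Walk.ofPath q)
  | comp {a x y b : Q} (w : Walk a x) {p q : Walk x y} (w' : Walk y b) : Homotopic I p q →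
      Homotopic I ((w.comp p).comp w') ((w.comp q).comp w')

variable (Q) in
/-- The fundamental group `π₁(Q, x₀)` of the underlying graph of `Q`: closed walks at `x₀` up to
cancellation of `α α⁻¹` and `α⁻¹ α`, that is, the vertex group of the free groupoid on `Q`. -/
abbrev GraphFundamentalGroup (x₀ : Q) : Type (max u v) :=
  End ((Quiver.FreeGroupoid.of Q).obj x₀)

/-- The class of a closed walk in the fundamental group of the underlying graph. -/
def Walk.toGroup {x₀ : Q} (w : Walk x₀ x₀) : GraphFundamentalGroup Q x₀ :=
  (Quotient.functor Quiver.FreeGroupoid.redStep).map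
    (X := (x₀ : Paths (Quiver.Symmetrify Q))) (Y := (x₀ : Paths (Quiver.Symmetrify Q))) w

/-- The normal subgroup `N(Q, I, x₀)`, generated by the closed walks which follow a walk `w` from
`x₀` to `x`, a path `v` from `x` to `y`, the inverse of a path `u` homotopic to `v`, and the
inverse of `w`. -/
def homotopySubgroup (I : TwoSidedIdeal (PathAlgebra k Q)) (x₀ : Q) :
    Subgroup (GraphFundamentalGroup Q x₀) :=
  Subgroup.normalClosure {g | ∃ (x y : Q) (w : Walk x₀ x) (u v : Quiver.Path x y),
    Homotopic I (Walk.ofPath u) (Walk.ofPath v) ∧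
    g = Walk.toGroup
      (((w.comp (Walk.ofPath v)).comp (Walk.ofPath u).reverse).comp w.reverse)}

instance (I : TwoSidedIdeal (PathAlgebra k Q)) (x₀ : Q) : (homotopySubgroup I x₀).Normal :=
  Subgroup.normalClosure_normal

/-- The fundamental group `π₁(Q, I) = π₁(Q, x₀) / N(Q, I, x₀)` of a bound quiver. -/
abbrev QuiverFundamentalGroup (I : TwoSidedIdeal (PathAlgebra k Q)) (x₀ : Q) : Type (max u v) :=
  GraphFundamentalGroup Q x₀ ⧸ homotopySubgroup I x₀

/-! ### The classifying space -/

/-- The relation on morphisms of the path category of `Q`: to appear in the same minimal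
relation. -/
def minimalHomRel (I : TwoSidedIdeal (PathAlgebra k Q)) :
    @HomRel (Paths Q) (Paths.categoryPaths Q).toQuiver :=
  fun _ _ p q => InMinimalRelation I (Q := Q) p q

/-- The category with objects the vertices of `Q` and with morphisms the natural homotopy classes
of paths. Natural homotopy is the smallest equivalence relation on paths that contains all pairs
of paths appearing in the same minimal relation and that is stable under composition with paths
on both sides. -/
abbrev NatHomotopyCategory (I : TwoSidedIdeal (PathAlgebra k Q)) : Type u :=
  Quotient (minimalHomRel I)

/-- The functor sending a path to its natural homotopy class. -/
abbrev natClass (I : TwoSidedIdeal (PathAlgebra k Q)) : Paths Q ⥤ NatHomotopyCategory I :=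
  Quotient.functor (minimalHomRel I)

/-- The length of a path, viewed as a morphism of the path category. -/
def homLength {x y : Paths Q} (p : (Paths.categoryPaths Q).Hom x y) : ℕ :=
  Quiver.Path.length (V := Q) p

variable (k) in
/-- The basis vector of `kQ` given by a path, viewed as a morphism of the path category. -/
def PathAlgebra.ofHom {x y : Paths Q} (p : (Paths.categoryPaths Q).Hom x y) : PathAlgebra k Q :=
  PathAlgebra.ofPath k (Q := Q) p

theorem homLength_comp {x y z : Paths Q} (p : (Paths.categoryPaths Q).Hom x y)
    (q : (Paths.categoryPaths Q).Hom y z) :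
    homLength (p ≫ q) = homLength p + homLength q :=
  Quiver.Path.length_comp (V := Q) p q

theorem PathAlgebra.ofHom_comp {x y z : Paths Q} (p : (Paths.categoryPaths Q).Hom x y)
    (q : (Paths.categoryPaths Q).Hom y z) :
    PathAlgebra.ofHom k (p ≫ q) = PathAlgebra.ofHom k p * PathAlgebra.ofHom k q :=
  (PathAlgebra.ofPath_mul_ofPath (Q := Q) p q).symm

/-- A composable sequence of paths `σ₁, …, σₙ`, none of them stationary, whose composite
`σ₁ ⋯ σₙ` is not in `I`. -/
def IsNonzeroSequence (I : TwoSidedIdeal (PathAlgebra k Q)) {n : ℕ}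
    (σ : ComposableArrows (Paths Q) n) : Prop :=
  (∀ i : Fin n, homLength (σ.map (homOfLE i.castSucc_le_succ)) ≠ 0) ∧
    PathAlgebra.ofHom k (σ.map (homOfLE (Fin.zero_le (Fin.last n)))) ∉ I

/-- The set `Cₙ` of `n`-cells: sequences of natural homotopy classes which have representatives
`σ₁, …, σₙ`, none of them stationary, with `σ₁ ⋯ σₙ ∉ I`. For `n = 0` these are the vertices. -/
def Cell (I : TwoSidedIdeal (PathAlgebra k Q)) (n : ℕ) : Type (max u v) :=
  {c : ComposableArrows (NatHomotopyCategory I) n //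
    ∃ σ : ComposableArrows (Paths Q) n, IsNonzeroSequence I σ ∧ σ ⋙ natClass I = c}

/-- Omitting the `i`-th vertex of a composable sequence of morphisms: the outer faces drop the
first or the last morphism, the inner ones compose two consecutive morphisms. -/
def omitVertex {C : Type*} [Category C] {n : ℕ} (i : Fin (n + 2))
    (σ : ComposableArrows C (n + 1)) : ComposableArrows C n :=
  (Fin.strictMono_succAbove i).monotone.functor ⋙ σ

theorem IsNonzeroSequence.length_ne_zero {I : TwoSidedIdeal (PathAlgebra k Q)} {n : ℕ}
    {σ : ComposableArrows (Paths Q) n} (h : IsNonzeroSequence I σ) {i j : Fin (n + 1)}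
    (hij : i < j) : homLength (σ.map (homOfLE hij.le)) ≠ 0 := by
  obtain ⟨i, rfl⟩ := Fin.exists_castSucc_eq.2 (Fin.ne_last_of_lt hij)
  have h1 : i.succ ≤ j := Fin.castSucc_lt_iff_succ_le.1 hij
  have h2 : σ.map (homOfLE hij.le) =
      σ.map (homOfLE i.castSucc_le_succ) ≫ σ.map (homOfLE h1) := by
    rw [← σ.map_comp]; rfl
  have := h.1 i
  rw [h2, homLength_comp]
  omega

theorem IsNonzeroSequence.omitVertex {I : TwoSidedIdeal (PathAlgebra k Q)} {n : ℕ}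
    {σ : ComposableArrows (Paths Q) (n + 1)} (h : IsNonzeroSequence I σ) (i : Fin (n + 2)) :
    IsNonzeroSequence I (omitVertex i σ) := by
  refine ⟨fun j => h.length_ne_zero (Fin.strictMono_succAbove i j.castSucc_lt_succ), fun hI => ?_⟩
  apply h.2
  let a := i.succAbove 0
  let b := i.succAbove (Fin.last n)
  have hab : a ≤ b := (Fin.strictMono_succAbove i).monotone (Fin.zero_le _)
  have e : σ.map (homOfLE (Fin.zero_le (Fin.last (n + 1)))) =
      σ.map (homOfLE (Fin.zero_le a)) ≫ σ.map (homOfLE hab) ≫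
      σ.map (homOfLE (Fin.le_last b)) := by
    rw [← σ.map_comp, ← σ.map_comp]; rfl
  rw [e, PathAlgebra.ofHom_comp, PathAlgebra.ofHom_comp]
  exact I.mul_mem_left _ _ (I.mul_mem_right _ _ hI)

/-- The face maps `∂ᵢ : Cₙ₊₁ → Cₙ`. -/
def Cell.face {I : TwoSidedIdeal (PathAlgebra k Q)} {n : ℕ} (i : Fin (n + 2))
    (c : Cell I (n + 1)) : Cell I n :=
  ⟨omitVertex i c.1, by
    obtain ⟨σ, hσ, e⟩ := c.2
    exact ⟨omitVertex i σ, hσ.omitVertex i, by rw [← e]; rfl⟩⟩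

/-- The disjoint union of one standard simplex `Δⁿ` for each `n`-cell and each `n`. -/
abbrev CellSimplices (I : TwoSidedIdeal (PathAlgebra k Q)) : Type (max u v) :=
  Σ c : (Σ n : ℕ, Cell I n), stdSimplex ℝ (Fin (c.1 + 1))

/-- The gluing: the `i`-th face `tᵢ = 0` of the simplex of a cell `c` is attached to the simplex of
`∂ᵢ c`, by the affine identification that preserves the order of the vertices. -/
inductive CellSimplices.Glue (I : TwoSidedIdeal (PathAlgebra k Q)) :
    CellSimplices I → CellSimplices I → Prop
  | face {n : ℕ} (c : Cell I (n + 1)) (i : Fin (n + 2)) (t : stdSimplex ℝ (Fin (n + 1))) :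
      Glue I ⟨⟨n + 1, c⟩, stdSimplex.map i.succAbove t⟩ ⟨⟨n, c.face i⟩, t⟩

/-- The classifying space `B(Q, I)`: the CW-complex obtained by attaching one simplex for each cell
along its faces, that is, the quotient of the disjoint union of the simplices (with the quotient
topology) by the equivalence relation generated by the gluing of faces. -/
def ClassifyingSpace (I : TwoSidedIdeal (PathAlgebra k Q)) : Type (max u v) :=
  Quot (CellSimplices.Glue I)

instance (I : TwoSidedIdeal (PathAlgebra k Q)) : TopologicalSpace (ClassifyingSpace I) :=
  inferInstanceAs (TopologicalSpace (Quot (CellSimplices.Glue I)))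

end BoundQuiver

end

/-! Sending an arrow to its 1-cell defines `edgeFunctor` from the free groupoid on `Q` to the
fundamental groupoid of the classifying space. On the vertex group at `x₀` it is onto with kernel
`homotopySubgroup I x₀`, which gives the isomorphism. Admissibility is used to have a cell for every
vertex and arrow. Acyclicity makes the vertices of a cell distinct, so that a vertex of `Q` singles
out at most one barycentric coordinate.

Surjectivity: the open stars of the vertices cover the space, and each contracts onto its vertex
along straight segments. A path is cut into pieces lying in single stars; at a common point of two
stars the two segments differ by an edge of a cell (`starHom_inv_comp_mem_edgePaths`). Hence every
loop at a vertex is an edge path (`starConj_mem_edgePaths`).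

The subgroup lies in the kernel: 2-cells make the edge of a nonzero path the product of the edges of
its arrows, and paths in one minimal relation have the same 1-cell
(`edgeFunctor_map_eq_of_homotopic`).

The kernel lies in the subgroup: natural homotopy classes take values in `G = π₁(Q, I)` once walks
are closed up along chosen walks from `x₀`. These values are the transition functions, on overlaps
of stars, of a covering with fibre `G` (`coveringCore`), in which the monodromy of an edge path is
left multiplication by its value. A walk with null-homotopic image has trivial monodromy, hence
trivial class. -/

noncomputable section

/-! ### Characteristic maps of the cells -/

/-! ### Faces, barycentric coordinates and segments in standard simplices. -/

section Simplex

theorem stdSimplex.map_succAbove_apply_self {n : ℕ} (a : Fin (n + 2))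
    (t : stdSimplex ℝ (Fin (n + 1))) : stdSimplex.map a.succAbove t a = 0 := by
  rw [stdSimplex.map_coe, FunOnFinite.linearMap_apply_apply]
  exact Finset.sum_eq_zero fun i hi => absurd (Finset.mem_filter.1 hi).2 (Fin.succAbove_ne a i)

theorem stdSimplex.map_succAbove_apply {n : ℕ} (a : Fin (n + 2))
    (t : stdSimplex ℝ (Fin (n + 1))) (i : Fin (n + 1)) :
    stdSimplex.map a.succAbove t (a.succAbove i) = t i := by
  rw [stdSimplex.map_coe, FunOnFinite.linearMap_apply_apply, Finset.sum_eq_single i]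
  · intro j hj hne
    exact absurd (Fin.succAbove_right_injective (Finset.mem_filter.1 hj).2) hne
  · intro h
    exact absurd (by simp) h

theorem stdSimplex.exists_pos {n : ℕ} (t : stdSimplex ℝ (Fin (n + 1))) : ∃ i, 0 < t i := by
  by_contra! h
  have := Finset.sum_nonpos fun i (_ : i ∈ Finset.univ) => h i
  rw [stdSimplex.sum_eq_one] at this
  linarith

theorem stdSimplex.continuous_apply {n : ℕ} (i : Fin (n + 1)) :
    Continuous fun t : stdSimplex ℝ (Fin (n + 1)) => t i :=
  (_root_.continuous_apply i).comp continuous_subtype_val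

/-- The straight line segment between two points of a simplex. -/
def stdSimplex.line {n : ℕ} (s t : stdSimplex ℝ (Fin (n + 1))) (r : unitInterval) :
    stdSimplex ℝ (Fin (n + 1)) :=
  ⟨(1 - (r : ℝ)) • s.1 + (r : ℝ) • t.1, convex_stdSimplex ℝ (Fin (n + 1)) s.2 t.2
    (sub_nonneg.2 r.2.2) r.2.1 (by ring)⟩

theorem stdSimplex.line_apply {n : ℕ} (s t : stdSimplex ℝ (Fin (n + 1))) (r : unitInterval)
    (i : Fin (n + 1)) : stdSimplex.line s t r i = (1 - (r : ℝ)) * s i + r * t i := rfl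

theorem stdSimplex.continuous_line {n : ℕ} (t : stdSimplex ℝ (Fin (n + 1))) :
    Continuous fun p : stdSimplex ℝ (Fin (n + 1)) × unitInterval => stdSimplex.line p.1 t p.2 := by
  refine Continuous.subtype_mk ?_ _
  fun_prop

theorem stdSimplex.line_zero {n : ℕ} (s t : stdSimplex ℝ (Fin (n + 1))) :
    stdSimplex.line s t 0 = s := by
  apply Subtype.ext; simp [stdSimplex.line]

theorem stdSimplex.line_one {n : ℕ} (s t : stdSimplex ℝ (Fin (n + 1))) :
    stdSimplex.line s t 1 = t := by
  apply Subtype.ext; simp [stdSimplex.line]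

theorem stdSimplex.map_line {n : ℕ} (a : Fin (n + 2)) (s t : stdSimplex ℝ (Fin (n + 1)))
    (r : unitInterval) :
    stdSimplex.map a.succAbove (stdSimplex.line s t r) =
      stdSimplex.line (stdSimplex.map a.succAbove s) (stdSimplex.map a.succAbove t) r := by
  ext i
  obtain rfl | ⟨j, rfl⟩ := Fin.eq_self_or_eq_succAbove a i
  · simp only [stdSimplex.line_apply, stdSimplex.map_succAbove_apply_self, mul_zero, add_zero]
  · simp only [stdSimplex.line_apply, stdSimplex.map_succAbove_apply]

instance stdSimplex.contractibleSpace (n : ℕ) : ContractibleSpace (stdSimplex ℝ (Fin (n + 1))) :=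
  (convex_stdSimplex ℝ (Fin (n + 1))).contractibleSpace ⟨_, (stdSimplex.vertex 0).2⟩

end Simplex

/-! ### Cells, open stars and edges of the classifying space. -/

section ClassifyingSpace

variable {k : Type w} {Q : Type u} [Field k] [Quiver.{v} Q] {I : TwoSidedIdeal (PathAlgebra k Q)}

namespace Cell

/-- The `i`-th vertex of a cell. -/
def vert {n : ℕ} (c : Cell I n) (i : Fin (n + 1)) : Q := (c.1.obj i).as

/-- The point of the classifying space with barycentric coordinates `t` in a cell. -/
def point {n : ℕ} (c : Cell I n) (t : stdSimplex ℝ (Fin (n + 1))) : ClassifyingSpace I :=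
  Quot.mk _ ⟨⟨n, c⟩, t⟩

theorem point_map_succAbove {n : ℕ} (c : Cell I (n + 1)) (a : Fin (n + 2))
    (t : stdSimplex ℝ (Fin (n + 1))) :
    c.point (stdSimplex.map a.succAbove t) = (c.face a).point t :=
  Quot.sound (.face c a t)

theorem continuous_point {n : ℕ} (c : Cell I n) : Continuous c.point :=
  continuous_quot_mk.comp (continuous_sigmaMk (σ := fun c : Σ n : ℕ, Cell I n =>
    stdSimplex ℝ (Fin (c.1 + 1))) (i := ⟨n, c⟩))

/-- The characteristic map of a cell. -/
def charMap {n : ℕ} (c : Cell I n) : C(stdSimplex ℝ (Fin (n + 1)), ClassifyingSpace I) :=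
  ⟨c.point, c.continuous_point⟩

/-- The cell of a nonzero composable sequence of paths. -/
def ofSequence {n : ℕ} (σ : ComposableArrows (Paths Q) n) (h : IsNonzeroSequence I σ) :
    Cell I n :=
  ⟨σ ⋙ natClass I, σ, h, rfl⟩

/-- Two equal vertices would be joined by a non-stationary closed path. -/
theorem vert_injective (htri : ∀ (x : Q) (p : Quiver.Path x x), p.length = 0) {n : ℕ}
    (c : Cell I n) : Function.Injective c.vert := by
  obtain ⟨_, σ, hσ, rfl⟩ := c
  have key : ∀ i j : Fin (n + 1), i < j → (σ.obj i : Q) ≠ σ.obj j := by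
    intro i j hij e
    have h1 := hσ.length_ne_zero hij
    -- The endpoints are made variables so that their equality can be substituted.
    have gen : ∀ (x y : Q) (p : Quiver.Path x y), x = y → p.length = 0 := by
      rintro x y p rfl
      exact htri x p
    exact h1 (gen _ _ _ e)
  intro i j hij
  rcases lt_trichotomy i j with h | h | h
  · exact absurd hij (key i j h)
  · exact h
  · exact absurd hij.symm (key j i h)

end Cell

theorem ClassifyingSpace.exists_point (x : ClassifyingSpace I) :
    ∃ (n : ℕ) (c : Cell I n) (t : stdSimplex ℝ (Fin (n + 1))), c.point t = x := by
  obtain ⟨z, hz⟩ := Quot.exists_rep x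
  exact ⟨z.1.1, z.1.2, z.2, hz⟩

theorem ClassifyingSpace.isOpen_iff {U : Set (ClassifyingSpace I)} :
    IsOpen U ↔ ∀ (n : ℕ) (c : Cell I n), IsOpen (c.point ⁻¹' U) := by
  refine isQuotientMap_quot_mk.isOpen_preimage.symm.trans
    (isOpen_sigma_iff.trans ⟨fun h n c => h ⟨n, c⟩, fun h c => h c.1 c.2⟩)

/-! ### Open stars -/

namespace CellSimplices

/-- The vertex `v` has a positive barycentric coordinate. -/
def Near (v : Q) (z : CellSimplices I) : Prop :=
  ∃ i, Cell.vert z.1.2 i = v ∧ 0 < z.2 i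

/-- The face inclusion keeps the coordinates of the face, and the one new coordinate is zero. -/
theorem Near.glue_iff (v : Q) {z z' : CellSimplices I} (h : Glue I z z') :
    Near v z ↔ Near v z' := by
  obtain ⟨c, a, t⟩ := h
  constructor
  · rintro ⟨i, hi, ht⟩
    obtain hia | ⟨j, rfl⟩ := Fin.eq_self_or_eq_succAbove a i
    · refine absurd ?_ ht.ne'
      rw [hia]
      exact stdSimplex.map_succAbove_apply_self _ t
    · exact ⟨j, hi, (stdSimplex.map_succAbove_apply a t j) ▸ ht⟩
  · rintro ⟨j, hj, ht⟩
    exact ⟨a.succAbove j, hj, (stdSimplex.map_succAbove_apply a t j).symm ▸ ht⟩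

end CellSimplices

variable (I) in
/-- The open star of a vertex in the classifying space. -/
def openStar (v : Q) : Set (ClassifyingSpace I) :=
  {x | Quot.lift (CellSimplices.Near v) (fun _ _ h => propext (CellSimplices.Near.glue_iff v h)) x}

theorem Cell.point_mem_openStar {n : ℕ} {c : Cell I n} {t : stdSimplex ℝ (Fin (n + 1))} {v : Q} :
    c.point t ∈ openStar I v ↔ ∃ i, c.vert i = v ∧ 0 < t i := Iff.rfl

theorem isOpen_openStar (v : Q) : IsOpen (openStar I v) := by
  rw [ClassifyingSpace.isOpen_iff]
  intro n c
  have : c.point ⁻¹' openStar I v = ⋃ i, ⋃ (_ : c.vert i = v), {t | 0 < t i} := by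
    ext t
    simp [Cell.point_mem_openStar]
  rw [this]
  exact isOpen_iUnion fun i => isOpen_iUnion fun _ =>
    isOpen_lt continuous_const (stdSimplex.continuous_apply i)

theorem exists_mem_openStar (x : ClassifyingSpace I) : ∃ v, x ∈ openStar I v := by
  obtain ⟨n, c, t, rfl⟩ := x.exists_point
  obtain ⟨i, hi⟩ := stdSimplex.exists_pos t
  exact ⟨c.vert i, i, rfl, hi⟩

/-! ### Vertices -/

/-- Stationary paths and arrows do not lie in `I`. -/
def ShortPathsNonzero (I : TwoSidedIdeal (PathAlgebra k Q)) : Prop :=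
  ∀ (x y : Q) (p : Quiver.Path x y), p.length ≤ 1 → PathAlgebra.ofPath k p ∉ I

theorem isNonzeroSequence_mk₀ (hs : ShortPathsNonzero I) (v : Q) :
    IsNonzeroSequence I (ComposableArrows.mk₀ (v : Paths Q)) :=
  ⟨fun i => i.elim0, hs v v Quiver.Path.nil (Nat.zero_le _)⟩

/-- The point of the classifying space given by a vertex. -/
def vertexPoint (hs : ShortPathsNonzero I) (v : Q) : ClassifyingSpace I :=
  (Cell.ofSequence _ (isNonzeroSequence_mk₀ hs v)).point (stdSimplex.vertex 0)

theorem Cell.eq_ofSequence_mk₀ (hs : ShortPathsNonzero I) (c : Cell I 0) (v : Q)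
    (h : c.vert 0 = v) : c = Cell.ofSequence _ (isNonzeroSequence_mk₀ hs v) := by
  subst h
  exact Subtype.ext (ComposableArrows.ext₀ rfl)

/-- Passing to a face that omits a vertex other than `i` lowers the dimension until a 0-cell is
left, and a 0-cell is determined by its vertex. -/
theorem Cell.point_vertex (hs : ShortPathsNonzero I) {n : ℕ} (c : Cell I n) (i : Fin (n + 1)) :
    c.point (stdSimplex.vertex i) = vertexPoint hs (c.vert i) := by
  induction n with
  | zero =>
    obtain rfl : i = 0 := Subsingleton.elim (α := Fin 1) _ _
    rw [vertexPoint, ← c.eq_ofSequence_mk₀ hs _ rfl]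
  | succ n ih =>
    obtain ⟨a, ha⟩ := exists_ne i
    obtain ⟨j, rfl⟩ := Fin.exists_succAbove_eq ha.symm
    rw [← stdSimplex.map_vertex, c.point_map_succAbove, ih]
    rfl

theorem vertexPoint_mem_openStar (hs : ShortPathsNonzero I) {v w : Q} :
    vertexPoint hs v ∈ openStar I w ↔ w = v := by
  rw [vertexPoint, Cell.point_mem_openStar]
  constructor
  · rintro ⟨i, hi, -⟩
    exact hi.symm
  · rintro rfl
    exact ⟨0, rfl, by simp⟩

theorem vertexPoint_injective (hs : ShortPathsNonzero I) :
    Function.Injective (vertexPoint hs) := by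
  intro v w h
  rw [← vertexPoint_mem_openStar hs, ← h, vertexPoint_mem_openStar hs]

/-! ### Paths inside a cell -/

/-- The class of the image of a path between two points of a simplex. -/
def Cell.hom {n : ℕ} (c : Cell I n) (s t : stdSimplex ℝ (Fin (n + 1))) :
    FundamentalGroupoid.mk (c.point s) ⟶ FundamentalGroupoid.mk (c.point t) :=
  FundamentalGroupoid.fromPath
    (Path.Homotopic.Quotient.mk ((PathConnectedSpace.somePath s t).map c.continuous_point))

/-- A simplex is simply connected, so the path chosen in it is immaterial. -/
theorem Cell.hom_eq {n : ℕ} (c : Cell I n) {s t : stdSimplex ℝ (Fin (n + 1))} (γ : Path s t) :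
    c.hom s t = FundamentalGroupoid.fromPath
      (Path.Homotopic.Quotient.mk (γ.map c.continuous_point)) :=
  (FundamentalGroupoid.fromPath_eq_iff_homotopic _ _).2
    ((SimplyConnectedSpace.paths_homotopic _ γ).map c.charMap)

theorem Cell.hom_self {n : ℕ} (c : Cell I n) (s : stdSimplex ℝ (Fin (n + 1))) :
    c.hom s s = 𝟙 _ := by
  rw [c.hom_eq (Path.refl s)]
  rfl

theorem Cell.hom_comp {n : ℕ} (c : Cell I n) (s t r : stdSimplex ℝ (Fin (n + 1))) :
    c.hom s t ≫ c.hom t r = c.hom s r := by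
  rw [c.hom_eq ((PathConnectedSpace.somePath s t).trans (PathConnectedSpace.somePath t r)),
    Path.map_trans]
  rfl

theorem Cell.hom_map_succAbove {n : ℕ} (c : Cell I (n + 1)) (a : Fin (n + 2))
    (s t : stdSimplex ℝ (Fin (n + 1))) :
    c.hom (stdSimplex.map a.succAbove s) (stdSimplex.map a.succAbove t) =
      eqToHom (congrArg _ (c.point_map_succAbove a s)) ≫ (c.face a).hom s t ≫
        eqToHom (congrArg _ (c.point_map_succAbove a t).symm) := by
  rw [c.hom_eq ((PathConnectedSpace.somePath s t).map (stdSimplex.continuous_map _)), Cell.hom,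
    FundamentalGroupoid.conj_eqToHom (c.point_map_succAbove a s) (c.point_map_succAbove a t)]
  refine congrArg Path.Homotopic.Quotient.mk (Path.ext (funext fun r => ?_))
  exact c.point_map_succAbove a _

/-- The class of the path running along the edge of a cell between two of its vertices. -/
def Cell.edge (hs : ShortPathsNonzero I) {n : ℕ} (c : Cell I n) (i j : Fin (n + 1)) :
    FundamentalGroupoid.mk (vertexPoint hs (c.vert i)) ⟶
      FundamentalGroupoid.mk (vertexPoint hs (c.vert j)) :=
  eqToHom (congrArg _ (c.point_vertex hs i).symm) ≫
    c.hom (stdSimplex.vertex i) (stdSimplex.vertex j) ≫ eqToHom (congrArg _ (c.point_vertex hs j))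

theorem Cell.edge_self (hs : ShortPathsNonzero I) {n : ℕ} (c : Cell I n) (i : Fin (n + 1)) :
    c.edge hs i i = 𝟙 _ := by
  simp [Cell.edge, Cell.hom_self]

/-- The boundary of a triangle is filled by the simplex; this is how 2-cells impose relations. -/
theorem Cell.edge_comp (hs : ShortPathsNonzero I) {n : ℕ} (c : Cell I n) (i j l : Fin (n + 1)) :
    c.edge hs i j ≫ c.edge hs j l = c.edge hs i l := by
  simp [Cell.edge, reassoc_of% c.hom_comp]

theorem Cell.edge_face (hs : ShortPathsNonzero I) {n : ℕ} (c : Cell I (n + 1)) (a : Fin (n + 2))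
    (i j : Fin (n + 1)) :
    (c.face a).edge hs i j = c.edge hs (a.succAbove i) (a.succAbove j) := by
  -- The face inclusion maps vertices to vertices only up to a propositional equality, which has to
  -- be transported along morphisms.
  have key : ∀ (s t s' t' : stdSimplex ℝ (Fin (n + 2))) (hs' : s = s') (ht : t = t'),
      c.hom s t = eqToHom (by rw [hs']) ≫ c.hom s' t' ≫ eqToHom (by rw [ht]) := by
    rintro s t _ _ rfl rfl
    simp
  have h : (c.face a).hom (stdSimplex.vertex i) (stdSimplex.vertex j) =
      eqToHom (congrArg _ (c.point_map_succAbove a _).symm) ≫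
        c.hom (stdSimplex.map a.succAbove (stdSimplex.vertex i))
          (stdSimplex.map a.succAbove (stdSimplex.vertex j)) ≫
        eqToHom (congrArg _ (c.point_map_succAbove a _)) := by
    rw [c.hom_map_succAbove]
    simp
  rw [key _ _ _ _ (stdSimplex.map_vertex _ i) (stdSimplex.map_vertex _ j)] at h
  simp only [Cell.edge, h, Category.assoc, eqToHom_trans, eqToHom_trans_assoc]
  rfl

theorem Cell.edge_congr (hs : ShortPathsNonzero I) {n : ℕ} {c c' : Cell I n} (h : c = c')
    (i j : Fin (n + 1)) :
    c.edge hs i j = eqToHom (by rw [h]) ≫ c'.edge hs i j ≫ eqToHom (by rw [h]) := by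
  subst h
  simp

end ClassifyingSpace

end

noncomputable section

section EdgeFunctor

variable {k : Type w} {Q : Type u} [Field k] [Quiver.{v} Q] {I : TwoSidedIdeal (PathAlgebra k Q)}

/-! ### Walks in the free groupoid -/

/-- The class of a walk in the free groupoid. -/
def Walk.toFree {x y : Q} (w : Walk x y) :
    (Quiver.FreeGroupoid.of Q).obj x ⟶ (Quiver.FreeGroupoid.of Q).obj y :=
  (Quotient.functor Quiver.FreeGroupoid.redStep).map
    (X := (x : Paths (Quiver.Symmetrify Q))) (Y := (y : Paths (Quiver.Symmetrify Q))) w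

theorem Walk.toFree_comp {x y z : Q} (w : Walk x y) (w' : Walk y z) :
    Walk.toFree (w.comp w') = w.toFree ≫ w'.toFree := rfl

theorem Walk.toFree_reverse {x y : Q} (w : Walk x y) :
    Walk.toFree w.reverse = Groupoid.inv w.toFree := rfl

theorem Walk.toFree_surjective {x y : Q}
    (g : (Quiver.FreeGroupoid.of Q).obj x ⟶ (Quiver.FreeGroupoid.of Q).obj y) :
    ∃ w : Walk x y, w.toFree = g :=
  Quot.exists_rep g

theorem Walk.toFree_ofPath_cons {x y z : Q} (p : Quiver.Path x y) (α : y ⟶ z) :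
    Walk.toFree (Walk.ofPath (p.cons α)) =
      Walk.toFree (Walk.ofPath p) ≫ (Quiver.FreeGroupoid.of Q).map α := rfl

/-- A functor on the free groupoid that identifies the paths appearing in a minimal relation
identifies homotopic walks. -/
theorem Homotopic.map_eq {D : Type*} [Category* D] (F : Quiver.FreeGroupoid Q ⥤ D)
    (hF : ∀ {x y : Q} (p q : Quiver.Path x y), InMinimalRelation I p q →
      F.map (Walk.ofPath p).toFree = F.map (Walk.ofPath q).toFree)
    {x y : Q} {p q : Walk x y} (h : Homotopic I p q) : F.map p.toFree = F.map q.toFree := by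
  induction h with
  | refl => rfl
  | symm _ ih => exact ih.symm
  | trans _ _ ih ih' => exact ih.trans ih'
  | arrow_inv α => rw [Walk.toFree_comp, Walk.toFree_reverse, Groupoid.comp_inv]; rfl
  | inv_arrow α => rw [Walk.toFree_comp, Walk.toFree_reverse, Groupoid.inv_comp]; rfl
  | minimal h => exact hF _ _ h
  | comp w w' _ ih => simp only [Walk.toFree_comp, Functor.map_comp, ih]

/-! ### Edges of the classifying space -/

/-- A minimal relation has at least two terms, so `{p}` is a proper nonempty part of it and its term
is not in `I`. -/
theorem InMinimalRelation.left_notMem {x y : Q} {p q : Quiver.Path x y}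
    (h : InMinimalRelation I p q) : PathAlgebra.ofPath k p ∉ I := by
  obtain ⟨r, ⟨-, hc, hr⟩, hp, -⟩ := h
  have hss : ({p} : Finset (Quiver.Path x y)) ⊂ r.support := by
    refine (Finset.singleton_subset_iff.2 hp).ssubset_of_ne fun e => ?_
    rw [← e, Finset.card_singleton] at hc
    omega
  have := hr {p} hss (Finset.singleton_nonempty p)
  rw [Finset.sum_singleton] at this
  intro hpI
  apply this
  -- A two-sided ideal is closed under ring multiplication; the scalar is absorbed into a multiple
  -- of the stationary path.
  have e : r p • PathAlgebra.ofPath k p =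
      (r p • PathAlgebra.ofPath k (Quiver.Path.nil : Quiver.Path x x)) * PathAlgebra.ofPath k p := by
    rw [PathAlgebra.smul_mul, PathAlgebra.ofPath_mul_ofPath, Quiver.Path.nil_comp]
  rw [e]
  exact I.mul_mem_left _ _ hpI

theorem InMinimalRelation.symm {x y : Q} {p q : Quiver.Path x y}
    (h : InMinimalRelation I p q) : InMinimalRelation I q p := by
  obtain ⟨r, h, hp, hq⟩ := h
  exact ⟨r, h, hq, hp⟩

theorem isNonzeroSequence_mk₁ {x y : Paths Q} {p : (Paths.categoryPaths Q).Hom x y}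
    (h0 : homLength p ≠ 0) (h : PathAlgebra.ofHom k p ∉ I) :
    IsNonzeroSequence I (ComposableArrows.mk₁ p) := by
  refine ⟨fun i => ?_, h⟩
  obtain rfl : i = 0 := Subsingleton.elim _ _
  exact h0

theorem isNonzeroSequence_mk₂ {x y z : Paths Q} {p : (Paths.categoryPaths Q).Hom x y}
    {q : (Paths.categoryPaths Q).Hom y z}
    (hp : homLength p ≠ 0) (hq : homLength q ≠ 0) (h : PathAlgebra.ofHom k (p ≫ q) ∉ I) :
    IsNonzeroSequence I (ComposableArrows.mk₂ p q) := by
  refine ⟨fun i => ?_, h⟩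
  fin_cases i
  · exact hp
  · exact hq

/-- The homotopy class of the path in the classifying space along the 1-cell of a path of `Q`. -/
def pathEdge (hs : ShortPathsNonzero I) {x y : Paths Q} (p : (Paths.categoryPaths Q).Hom x y)
    (h0 : homLength p ≠ 0) (h : PathAlgebra.ofHom k p ∉ I) :
    FundamentalGroupoid.mk (vertexPoint hs x) ⟶ FundamentalGroupoid.mk (vertexPoint hs y) :=
  (Cell.ofSequence _ (isNonzeroSequence_mk₁ h0 h)).edge hs 0 1

theorem IsNonzeroSequence.map_notMem {n : ℕ} {σ : ComposableArrows (Paths Q) n}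
    (h : IsNonzeroSequence I σ) {i j : Fin (n + 1)} (hij : i ≤ j) :
    PathAlgebra.ofHom k (σ.map (homOfLE hij)) ∉ I := by
  intro hI
  apply h.2
  have e : σ.map (homOfLE (Fin.zero_le (Fin.last n))) =
      σ.map (homOfLE (Fin.zero_le i)) ≫ σ.map (homOfLE hij) ≫
      σ.map (homOfLE (Fin.le_last j)) := by
    rw [← σ.map_comp, ← σ.map_comp]; rfl
  rw [e, PathAlgebra.ofHom_comp, PathAlgebra.ofHom_comp]
  exact I.mul_mem_left _ _ (I.mul_mem_right _ _ hI)

/-- From dimension two on there is a vertex other than `i` and `j`; omitting it reduces to the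
1-cell of the path from `i` to `j`. -/
theorem Cell.edge_ofSequence (hs : ShortPathsNonzero I) {n : ℕ} {σ : ComposableArrows (Paths Q) n}
    (h : IsNonzeroSequence I σ) {i j : Fin (n + 1)} (hij : i < j) :
    (Cell.ofSequence σ h).edge hs i j =
      pathEdge hs (σ.map (homOfLE hij.le)) (h.length_ne_zero hij) (h.map_notMem hij.le) := by
  match n with
  | 0 => exact absurd hij (by omega)
  | 1 =>
    obtain ⟨x, y, p, rfl⟩ := ComposableArrows.mk₁_surjective σ
    fin_cases i <;> fin_cases j <;> first | rfl | exact absurd hij (by decide)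
  | n + 2 =>
    obtain ⟨a, ha⟩ : ∃ a : Fin (n + 3), a ∉ ({i, j} : Finset (Fin (n + 3))) := by
      by_contra! hc
      have := Finset.card_le_card (fun a _ => hc a : Finset.univ ⊆ ({i, j} : Finset _))
      have h2 := Finset.card_le_two (a := i) (b := j)
      rw [Finset.card_univ, Fintype.card_fin] at this
      omega
    simp only [Finset.mem_insert, Finset.mem_singleton, not_or] at ha
    obtain ⟨i, rfl⟩ := Fin.exists_succAbove_eq (Ne.symm ha.1)
    obtain ⟨j, rfl⟩ := Fin.exists_succAbove_eq (Ne.symm ha.2)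
    have hij' : i < j := (Fin.strictMono_succAbove a).lt_iff_lt.1 hij
    rw [← Cell.edge_face]
    exact Cell.edge_ofSequence hs (h.omitVertex a) hij'

/-- Since the composite is not in `I`, the pair `(p, q)` spans a 2-cell, and its three edges are the
ones compared. -/
theorem pathEdge_comp (hs : ShortPathsNonzero I) {x y z : Paths Q}
    (p : (Paths.categoryPaths Q).Hom x y) (q : (Paths.categoryPaths Q).Hom y z)
    (hp : homLength p ≠ 0) (hq : homLength q ≠ 0) (hpI : PathAlgebra.ofHom k p ∉ I)
    (hqI : PathAlgebra.ofHom k q ∉ I) (h0 : homLength (p ≫ q) ≠ 0)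
    (h : PathAlgebra.ofHom k (p ≫ q) ∉ I) :
    pathEdge hs (p ≫ q) h0 h = pathEdge hs p hp hpI ≫ pathEdge hs q hq hqI := by
  have hσ := isNonzeroSequence_mk₂ hp hq h
  have := (Cell.ofSequence _ hσ).edge_comp hs 0 1 2
  rw [Cell.edge_ofSequence hs hσ (by decide : (0 : Fin 3) < 1),
    Cell.edge_ofSequence hs hσ (by decide : (1 : Fin 3) < 2),
    Cell.edge_ofSequence hs hσ (by decide : (0 : Fin 3) < 2)] at this
  exact this.symm

/-- Cells are made of natural homotopy classes, so both paths give one and the same 1-cell. -/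
theorem pathEdge_eq_of_natClass_eq (hs : ShortPathsNonzero I) {x y : Paths Q}
    {p q : (Paths.categoryPaths Q).Hom x y} (hp : homLength p ≠ 0) (hq : homLength q ≠ 0)
    (hpI : PathAlgebra.ofHom k p ∉ I) (hqI : PathAlgebra.ofHom k q ∉ I)
    (h : (natClass I).map p = (natClass I).map q) :
    pathEdge hs p hp hpI = pathEdge hs q hq hqI := by
  have e : Cell.ofSequence _ (isNonzeroSequence_mk₁ hp hpI) =
      Cell.ofSequence _ (isNonzeroSequence_mk₁ hq hqI) := by
    exact Subtype.ext (ComposableArrows.ext₁ rfl rfl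
      (h.trans ((Category.id_comp _).trans (Category.comp_id _)).symm))
  exact (Cell.edge_congr hs e 0 1).trans ((Category.id_comp _).trans (Category.comp_id _))

/-! ### The functor from the free groupoid to the fundamental groupoid -/

/-- The prefunctor sending an arrow of `Q` to the corresponding edge of the classifying space. -/
def arrowEdge (hs : ShortPathsNonzero I) : Q ⥤q FundamentalGroupoid (ClassifyingSpace I) where
  obj v := .mk (vertexPoint hs v)
  map {x y} α := pathEdge hs (x := x) (y := y) α.toPath one_ne_zero (hs x y α.toPath le_rfl)

/-- The functor sending a walk to the homotopy class of the corresponding path in the classifying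
space. -/
def edgeFunctor (hs : ShortPathsNonzero I) :
    Quiver.FreeGroupoid Q ⥤ FundamentalGroupoid (ClassifyingSpace I) :=
  Quiver.FreeGroupoid.lift (arrowEdge hs)

theorem edgeFunctor_map_of (hs : ShortPathsNonzero I) {x y : Q} (α : x ⟶ y) :
    (edgeFunctor hs).map ((Quiver.FreeGroupoid.of Q).map α) =
      pathEdge hs (x := x) (y := y) α.toPath one_ne_zero (hs x y α.toPath le_rfl) :=
  Category.id_comp _

/-- Initial segments of a path outside `I` are outside `I`, so 2-cells allow arrows to be split off
one at a time. -/
theorem edgeFunctor_map_path (hs : ShortPathsNonzero I) {x y : Q} (p : Quiver.Path x y)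
    (h0 : p.length ≠ 0) (h : PathAlgebra.ofPath k p ∉ I) :
    (edgeFunctor hs).map (Walk.ofPath p).toFree =
      pathEdge hs (x := x) (y := y) p h0 h := by
  induction p with
  | nil => exact absurd rfl h0
  | @cons z y p α ih =>
    rw [Walk.toFree_ofPath_cons, Functor.map_comp, edgeFunctor_map_of]
    match z, p, α, ih, h0, h with
    -- A single arrow is the true base case: stationary paths have no 1-cell.
    | _, .nil, α, _, _, _ => exact Category.id_comp _
    | z, .cons p β, α, ih, h0, h =>
      have hp : PathAlgebra.ofPath k (p.cons β) ∉ I := by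
        intro hp
        apply h
        have := I.mul_mem_right _ (PathAlgebra.ofPath k α.toPath) hp
        rwa [PathAlgebra.ofPath_mul_ofPath] at this
      rw [ih (Nat.succ_ne_zero _) hp]
      exact (pathEdge_comp hs (x := x) (y := z) (z := y) (p.cons β) α.toPath _ _ _ _ h0 h).symm

/-- At an acyclic vertex the stationary path is the only closed path, while a minimal relation needs
two distinct parallel ones. -/
theorem InMinimalRelation.length_ne_zero (htri : ∀ (x : Q) (p : Quiver.Path x x), p.length = 0)
    {x y : Q} {p q : Quiver.Path x y} (h : InMinimalRelation I p q) : p.length ≠ 0 := by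
  intro h0
  obtain rfl := Quiver.Path.eq_of_length_zero p h0
  obtain ⟨r, ⟨-, hc, -⟩, -⟩ := h
  obtain ⟨p₁, -, p₂, -, hne⟩ := Finset.one_lt_card.1 hc
  apply hne
  rw [Quiver.Path.eq_nil_of_length_zero p₁ (htri x p₁),
    Quiver.Path.eq_nil_of_length_zero p₂ (htri x p₂)]

theorem edgeFunctor_map_eq_of_homotopic (htri : ∀ (x : Q) (p : Quiver.Path x x), p.length = 0)
    (hs : ShortPathsNonzero I) {x y : Q} {p q : Walk x y}
    (h : Homotopic I p q) : (edgeFunctor hs).map p.toFree = (edgeFunctor hs).map q.toFree := by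
  refine h.map_eq _ fun {x y} p q hpq => ?_
  rw [edgeFunctor_map_path hs p (hpq.length_ne_zero htri) hpq.left_notMem,
    edgeFunctor_map_path hs q (hpq.symm.length_ne_zero htri) hpq.symm.left_notMem]
  exact pathEdge_eq_of_natClass_eq hs _ _ _ _ (CategoryTheory.Quotient.sound _ hpq)

end EdgeFunctor

end

noncomputable section

section Contraction

variable {k : Type w} {Q : Type u} [Field k] [Quiver.{v} Q] {I : TwoSidedIdeal (PathAlgebra k Q)}

/-! ### Contracting the open stars -/

open Classical in
/-- Moving a point of a simplex along the straight line towards the vertex `v`. -/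
def CellSimplices.contract (v : Q) (r : unitInterval) (z : CellSimplices I) :
    ClassifyingSpace I :=
  if h : CellSimplices.Near v z then
    Cell.point z.1.2 (stdSimplex.line z.2 (stdSimplex.vertex h.choose) r)
  else Quot.mk _ z

theorem CellSimplices.contract_mk (htri : ∀ (x : Q) (p : Quiver.Path x x), p.length = 0)
    {v : Q} (r : unitInterval) {n : ℕ} (c : Cell I n) (t : stdSimplex ℝ (Fin (n + 1)))
    {i : Fin (n + 1)} (hi : c.vert i = v) (ht : 0 < t i) :
    CellSimplices.contract v r ⟨⟨n, c⟩, t⟩ =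
      c.point (stdSimplex.line t (stdSimplex.vertex i) r) := by
  have h : CellSimplices.Near v (⟨⟨n, c⟩, t⟩ : CellSimplices I) := ⟨i, hi, ht⟩
  refine (dif_pos h).trans (congrArg (fun j => c.point (stdSimplex.line t (stdSimplex.vertex j) r))
    (c.vert_injective htri (h.choose_spec.1.trans hi.symm)))

/-- Moving a point of the open star of a vertex `v` along the straight line towards `v`. -/
def contractStar (htri : ∀ (x : Q) (p : Quiver.Path x x), p.length = 0) (v : Q)
    (x : ClassifyingSpace I) (r : unitInterval) : ClassifyingSpace I :=
  Quot.lift (CellSimplices.contract v r) (by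
    intro z z' h
    -- Face inclusions are affine and respect vertices, so they carry the segment towards `v` to the
    -- segment towards `v`.
    by_cases hz : CellSimplices.Near v z'
    · obtain ⟨c, a, t⟩ := h
      obtain ⟨i, hi, ht⟩ := hz
      rw [CellSimplices.contract_mk htri r (c.face a) t hi ht,
        CellSimplices.contract_mk htri r c _ (i := a.succAbove i) hi
          ((stdSimplex.map_succAbove_apply a t i).symm ▸ ht),
        ← stdSimplex.map_vertex, ← stdSimplex.map_line, Cell.point_map_succAbove]
    · have hz' : ¬ CellSimplices.Near v z := fun hz' =>
        hz ((CellSimplices.Near.glue_iff v h).1 hz')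
      have e : CellSimplices.contract v r z' = Quot.mk _ z' := dif_neg hz
      rw [e]
      exact (dif_neg hz').trans (Quot.sound h)) x

theorem contractStar_point (htri : ∀ (x : Q) (p : Quiver.Path x x), p.length = 0)
    {v : Q} (r : unitInterval) {n : ℕ} (c : Cell I n) (t : stdSimplex ℝ (Fin (n + 1)))
    {i : Fin (n + 1)} (hi : c.vert i = v) (ht : 0 < t i) :
    contractStar htri v (c.point t) r = c.point (stdSimplex.line t (stdSimplex.vertex i) r) :=
  CellSimplices.contract_mk htri r c t hi ht

/-- The quotient map restricted to the open star is again a quotient map, and so is its product with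
the locally compact interval. Continuity can thus be tested on simplices. -/
theorem continuous_contractStar (htri : ∀ (x : Q) (p : Quiver.Path x x), p.length = 0) (v : Q) :
    Continuous fun p : openStar I v × unitInterval => contractStar (I := I) htri v p.1 p.2 := by
  have hq := (isQuotientMap_quot_mk (r := CellSimplices.Glue I)).restrictPreimage_isOpen
    (isOpen_openStar v)
  refine hq.continuous_lift_prod_left (g := fun p : openStar I v × unitInterval =>
    contractStar (I := I) htri v p.1 p.2) ?_
  have hopen : IsOpen (Quot.mk (CellSimplices.Glue I) ⁻¹' openStar I v) :=
    (isOpen_openStar v).preimage continuous_quot_mk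
  let F : CellSimplices I × unitInterval → ClassifyingSpace I :=
    fun p => contractStar htri v (Quot.mk _ p.1) p.2
  have key : ∀ p : CellSimplices I × unitInterval,
      p.1 ∈ Quot.mk (CellSimplices.Glue I) ⁻¹' openStar I v → ContinuousAt F p := by
    rintro ⟨⟨⟨n, c⟩, t⟩, r⟩ ⟨i, hi, ht⟩
    have hemb := (Topology.IsOpenEmbedding.sigmaMk (σ := fun c : Σ n : ℕ, Cell I n =>
      stdSimplex ℝ (Fin (c.1 + 1))) (i := ⟨n, c⟩)).prodMap
        (Topology.IsOpenEmbedding.id (X := unitInterval))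
    refine (hemb.continuousAt_iff (x := (t, r))).1 ?_
    have hc : ContinuousAt (fun p : stdSimplex ℝ (Fin (n + 1)) × unitInterval =>
        c.point (stdSimplex.line p.1 (stdSimplex.vertex i) p.2)) (t, r) :=
      (c.continuous_point.comp (stdSimplex.continuous_line _)).continuousAt
    refine hc.congr ?_
    -- The coordinate `i` stays positive nearby, so the same straight-line formula holds there.
    have : ∀ᶠ p : stdSimplex ℝ (Fin (n + 1)) × unitInterval in nhds (t, r), 0 < p.1 i :=
      (isOpen_lt continuous_const
        ((stdSimplex.continuous_apply i).comp continuous_fst)).mem_nhds ht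
    filter_upwards [this] with p hp
    exact (contractStar_point htri p.2 c p.1 hi hp).symm
  have hval : Continuous fun p : (Quot.mk (CellSimplices.Glue I) ⁻¹' openStar I v) × unitInterval =>
      ((p.1 : CellSimplices I), p.2) := by fun_prop
  exact continuous_iff_continuousAt.2 fun p =>
    ContinuousAt.comp (f := fun p : (Quot.mk (CellSimplices.Glue I) ⁻¹' openStar I v) ×
      unitInterval => ((p.1 : CellSimplices I), p.2)) (key (p.1.1, p.2) p.1.2) hval.continuousAt

theorem contractStar_zero (htri : ∀ (x : Q) (p : Quiver.Path x x), p.length = 0) {v : Q}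
    {x : ClassifyingSpace I} (hx : x ∈ openStar I v) : contractStar htri v x 0 = x := by
  obtain ⟨n, c, t, rfl⟩ := x.exists_point
  obtain ⟨i, hi, ht⟩ := Cell.point_mem_openStar.1 hx
  rw [contractStar_point htri 0 c t hi ht, stdSimplex.line_zero]

theorem contractStar_one (hs : ShortPathsNonzero I)
    (htri : ∀ (x : Q) (p : Quiver.Path x x), p.length = 0) {v : Q}
    {x : ClassifyingSpace I} (hx : x ∈ openStar I v) :
    contractStar htri v x 1 = vertexPoint hs v := by
  obtain ⟨n, c, t, rfl⟩ := x.exists_point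
  obtain ⟨i, hi, ht⟩ := Cell.point_mem_openStar.1 hx
  rw [contractStar_point htri 1 c t hi ht, stdSimplex.line_one, c.point_vertex hs, hi]

/-- The path from a point of the open star of `v` to `v`. -/
def starPath (hs : ShortPathsNonzero I) (htri : ∀ (x : Q) (p : Quiver.Path x x), p.length = 0)
    {v : Q} {x : ClassifyingSpace I} (hx : x ∈ openStar I v) : Path x (vertexPoint hs v) where
  toFun := contractStar htri v x
  continuous_toFun := (continuous_contractStar htri v).comp 
    (Continuous.prodMk_right (⟨x, hx⟩ : openStar I v))
  source' := contractStar_zero htri hx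
  target' := contractStar_one hs htri hx

/-- The homotopy class of the path from a point of the open star of `v` to `v`. -/
def starHom (hs : ShortPathsNonzero I) (htri : ∀ (x : Q) (p : Quiver.Path x x), p.length = 0)
    {v : Q} {x : ClassifyingSpace I} (hx : x ∈ openStar I v) :
    FundamentalGroupoid.mk x ⟶ FundamentalGroupoid.mk (vertexPoint hs v) :=
  FundamentalGroupoid.fromPath (Path.Homotopic.Quotient.mk (starPath hs htri hx))

theorem starHom_point (hs : ShortPathsNonzero I)
    (htri : ∀ (x : Q) (p : Quiver.Path x x), p.length = 0)
    {n : ℕ} (c : Cell I n) (t : stdSimplex ℝ (Fin (n + 1))) (i : Fin (n + 1)) (ht : 0 < t i) :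
    starHom hs htri (Cell.point_mem_openStar.2 ⟨i, rfl, ht⟩) =
      c.hom t (stdSimplex.vertex i) ≫ eqToHom (congrArg _ (c.point_vertex hs i)) := by
  let γ : Path t (stdSimplex.vertex i) :=
    { toFun := stdSimplex.line t (stdSimplex.vertex i)
      continuous_toFun := (stdSimplex.continuous_line _).comp (Continuous.prodMk_right t)
      source' := stdSimplex.line_zero _ _
      target' := stdSimplex.line_one _ _ }
  have := FundamentalGroupoid.conj_eqToHom (p := c.hom t (stdSimplex.vertex i)) rfl
    (c.point_vertex hs i).symm
  rw [eqToHom_refl, Category.id_comp] at this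
  rw [this, c.hom_eq γ]
  refine congrArg Path.Homotopic.Quotient.mk (Path.ext (funext fun r => ?_))
  exact contractStar_point htri r c t rfl ht

/-- A path that stays in an open star commutes with the contraction of the open star. -/
theorem comp_starHom (hs : ShortPathsNonzero I)
    (htri : ∀ (x : Q) (p : Quiver.Path x x), p.length = 0) {v : Q} {x y : ClassifyingSpace I}
    (γ : Path x y) (hγ : ∀ r, γ r ∈ openStar I v) (hx : x ∈ openStar I v)
    (hy : y ∈ openStar I v) :
    FundamentalGroupoid.fromPath (Path.Homotopic.Quotient.mk γ) ≫ starHom hs htri hy =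
      starHom hs htri hx := by
  let F : C(unitInterval × unitInterval, ClassifyingSpace I) :=
    ⟨fun p => contractStar htri v (γ p.1) p.2, (continuous_contractStar htri v).comp
      (((γ.continuous.comp continuous_fst).subtype_mk fun p => hγ p.1).prodMk continuous_snd)⟩
  let α : Path (0 : unitInterval) 1 := ⟨⟨id, continuous_id⟩, rfl, rfl⟩
  -- Two ways around the square: `F` sends `p₁` to `γ` followed by the contraction of `y`, and `p₂`
  -- to the contraction of `x` followed by a constant path.
  let p₁ : Path ((0 : unitInterval), (0 : unitInterval)) (1, 1) :=
    (α.prod (Path.refl 0)).trans ((Path.refl 1).prod α)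
  let p₂ : Path ((0 : unitInterval), (0 : unitInterval)) (1, 1) :=
    ((Path.refl 0).prod α).trans (α.prod (Path.refl 1))
  have : ContractibleSpace unitInterval := (convex_Icc (0 : ℝ) 1).contractibleSpace ⟨0, by simp⟩
  have h : p₁.Homotopic p₂ := SimplyConnectedSpace.paths_homotopic _ _
  have e₀ : x = F (0, 0) := by
    change x = contractStar htri v (γ 0) 0
    rw [γ.source, contractStar_zero htri hx]
  have e₁ : vertexPoint hs v = F (1, 1) := by
    change _ = contractStar htri v (γ 1) 1
    rw [γ.target, contractStar_one hs htri hy]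
  have h' := (h.map F).pathCast e₀ e₁
  have h₁ : (p₁.map F.continuous).cast e₀ e₁ = γ.trans (starPath hs htri hy) := by
    ext r
    simp only [Path.cast_coe, Path.map_coe, Function.comp_apply, p₁, Path.trans_apply]
    split_ifs with hr
    · exact contractStar_zero htri (hγ _)
    · exact congrArg (fun z => contractStar htri v z _) γ.target
  have h₂ : (p₂.map F.continuous).cast e₀ e₁ =
      (starPath hs htri hx).trans (Path.refl (vertexPoint hs v)) := by
    ext r
    simp only [Path.cast_coe, Path.map_coe, Function.comp_apply, p₂, Path.trans_apply]
    split_ifs with hr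
    · exact congrArg (fun z => contractStar htri v z _) γ.source
    · exact contractStar_one hs htri (hγ _)
  rw [h₁, h₂] at h'
  exact ((FundamentalGroupoid.fromPath_eq_iff_homotopic _ _).2 h').trans
    (Category.comp_id (starHom hs htri hx))

end Contraction

end

noncomputable section

section Surjectivity

variable {k : Type w} {Q : Type u} [Field k] [Quiver.{v} Q] {I : TwoSidedIdeal (PathAlgebra k Q)}

/-! ### Every path is homotopic to an edge path -/

/-- Injectivity on objects is what makes the image of the functor closed under composition. -/
theorem edgeFunctor_obj_injective (hs : ShortPathsNonzero I) :
    Function.Injective (edgeFunctor hs).obj := by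
  intro x y h
  have h' : x.as = y.as := vertexPoint_injective hs (congrArg FundamentalGroupoid.as h)
  exact congrArg CategoryTheory.Quotient.mk h'

/-- The subgroupoid of the classes of edge paths. -/
def edgePaths (hs : ShortPathsNonzero I) :
    Subgroupoid (FundamentalGroupoid (ClassifyingSpace I)) :=
  Subgroupoid.im (edgeFunctor hs) (edgeFunctor_obj_injective hs)

theorem edgeFunctor_map_mem_edgePaths (hs : ShortPathsNonzero I) {x y : Quiver.FreeGroupoid Q}
    (g : x ⟶ y) : (edgeFunctor hs).map g ∈ (edgePaths hs).arrows _ _ := by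
  refine (Subgroupoid.mem_im_iff _ (edgeFunctor_obj_injective hs) _).2 ⟨x, y, g, rfl, rfl, ?_⟩
  simp

theorem id_mem_edgePaths (hs : ShortPathsNonzero I) (v : Q) :
    𝟙 (FundamentalGroupoid.mk (vertexPoint hs v)) ∈ (edgePaths hs).arrows _ _ := by
  have := edgeFunctor_map_mem_edgePaths hs (𝟙 ((Quiver.FreeGroupoid.of Q).obj v))
  rwa [CategoryTheory.Functor.map_id] at this

/-- An increasing edge comes from a path of `Q`, a decreasing one is the inverse of such an edge. -/
theorem Cell.edge_mem_edgePaths (hs : ShortPathsNonzero I) {n : ℕ} (c : Cell I n)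
    (i j : Fin (n + 1)) : c.edge hs i j ∈ (edgePaths hs).arrows _ _ := by
  have key : ∀ i j : Fin (n + 1), i < j → c.edge hs i j ∈ (edgePaths hs).arrows _ _ := by
    intro i j hij
    obtain ⟨_, σ, hσ, rfl⟩ := c
    have := edgeFunctor_map_mem_edgePaths hs
      (Walk.toFree (Walk.ofPath (Q := Q) (σ.map (homOfLE hij.le))))
    rw [edgeFunctor_map_path hs _ (hσ.length_ne_zero hij) (hσ.map_notMem hij.le)] at this
    have e := Cell.edge_ofSequence hs hσ hij
    exact e ▸ this
  rcases lt_trichotomy i j with h | rfl | h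
  · exact key i j h
  · rw [c.edge_self]
    exact id_mem_edgePaths hs _
  · have := (edgePaths hs).inv (key j i h)
    have e : Groupoid.inv (c.edge hs j i) = c.edge hs i j := by
      rw [Groupoid.inv_eq_inv]
      exact IsIso.inv_eq_of_hom_inv_id ((c.edge_comp hs j i j).trans (c.edge_self hs j))
    rwa [e] at this

/-- A cell containing the point has both `v` and `w` among its vertices; inside it the two segments
compose to the edge from `v` to `w`. -/
theorem starHom_inv_comp_mem_edgePaths (hs : ShortPathsNonzero I)
    (htri : ∀ (x : Q) (p : Quiver.Path x x), p.length = 0) {v w : Q} {x : ClassifyingSpace I}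
    (hv : x ∈ openStar I v) (hw : x ∈ openStar I w) :
    Groupoid.inv (starHom hs htri hv) ≫ starHom hs htri hw ∈ (edgePaths hs).arrows _ _ := by
  obtain ⟨n, c, t, rfl⟩ := x.exists_point
  obtain ⟨i, rfl, hi⟩ := Cell.point_mem_openStar.1 hv
  obtain ⟨j, rfl, hj⟩ := Cell.point_mem_openStar.1 hw
  have e : Groupoid.inv (starHom hs htri hv) ≫ starHom hs htri hw = c.edge hs i j := by
    rw [Groupoid.inv_eq_inv, IsIso.inv_comp_eq, starHom_point hs htri c t i hi,
      starHom_point hs htri c t j hj, Cell.edge]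
    simp [reassoc_of% c.hom_comp]
  rw [e]
  exact c.edge_mem_edgePaths hs i j

/-- A path between two points, extended to the vertices of open stars containing them. -/
def starConj (hs : ShortPathsNonzero I) (htri : ∀ (x : Q) (p : Quiver.Path x x), p.length = 0)
    {v w : Q} {x y : ClassifyingSpace I} (hx : x ∈ openStar I v) (hy : y ∈ openStar I w)
    (γ : FundamentalGroupoid.mk x ⟶ FundamentalGroupoid.mk y) :
    FundamentalGroupoid.mk (vertexPoint hs v) ⟶ FundamentalGroupoid.mk (vertexPoint hs w) :=
  Groupoid.inv (starHom hs htri hx) ≫ γ ≫ starHom hs htri hy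

theorem starConj_comp (hs : ShortPathsNonzero I)
    (htri : ∀ (x : Q) (p : Quiver.Path x x), p.length = 0)
    {v w z : Q} {x y y' : ClassifyingSpace I} (hx : x ∈ openStar I v) (hy : y ∈ openStar I w)
    (hy' : y' ∈ openStar I z) (γ : FundamentalGroupoid.mk x ⟶ FundamentalGroupoid.mk y)
    (δ : FundamentalGroupoid.mk y ⟶ FundamentalGroupoid.mk y') :
    starConj hs htri hx hy' (γ ≫ δ) = starConj hs htri hx hy γ ≫ starConj hs htri hy hy' δ := by
  simp [starConj]

/-- Inside the star of `u` the path can be replaced by going to `u` and back out, which leaves two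
changes of star. -/
theorem starConj_mem_edgePaths_of_subset (hs : ShortPathsNonzero I)
    (htri : ∀ (x : Q) (p : Quiver.Path x x), p.length = 0)
    {u v w : Q} {x y : ClassifyingSpace I} (hx : x ∈ openStar I v) (hy : y ∈ openStar I w)
    (γ : Path x y) (hγ : ∀ r, γ r ∈ openStar I u) :
    starConj hs htri hx hy (FundamentalGroupoid.fromPath (Path.Homotopic.Quotient.mk γ)) ∈
      (edgePaths hs).arrows _ _ := by
  have hxu : x ∈ openStar I u := by simpa using hγ 0
  have hyu : y ∈ openStar I u := by simpa using hγ 1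
  have e : starConj hs htri hx hy (FundamentalGroupoid.fromPath (Path.Homotopic.Quotient.mk γ)) =
      (Groupoid.inv (starHom hs htri hx) ≫ starHom hs htri hxu) ≫
        (Groupoid.inv (starHom hs htri hyu) ≫ starHom hs htri hy) := by
    rw [← comp_starHom hs htri γ hγ hxu hyu]
    simp [starConj]
  rw [e]
  exact (edgePaths hs).mul (starHom_inv_comp_mem_edgePaths hs htri hx hxu)
    (starHom_inv_comp_mem_edgePaths hs htri hyu hy)

/-- Compactness of the interval gives a subdivision with each piece in one open star. -/
theorem starConj_mem_edgePaths (hs : ShortPathsNonzero I)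
    (htri : ∀ (x : Q) (p : Quiver.Path x x), p.length = 0)
    {v w : Q} {x y : ClassifyingSpace I} (hx : x ∈ openStar I v) (hy : y ∈ openStar I w)
    (γ : FundamentalGroupoid.mk x ⟶ FundamentalGroupoid.mk y) :
    starConj hs htri hx hy γ ∈ (edgePaths hs).arrows _ _ := by
  obtain ⟨γ, rfl⟩ := Path.Homotopic.Quotient.mk_surjective γ
  obtain ⟨t, ht0, htm, ⟨m, hm⟩, ht⟩ := exists_monotone_Icc_subset_open_cover_unitInterval
    (fun v => (isOpen_openStar (I := I) v).preimage γ.continuous)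
    (fun r _ => Set.mem_iUnion.2 (exists_mem_openStar (γ r)))
  -- The end stars are quantified so that the induction may end in the star containing the next
  -- piece.
  have key : ∀ (n : ℕ) (v w : Q) (hv : γ (t 0) ∈ openStar I v) (hw : γ (t n) ∈ openStar I w),
      starConj hs htri hv hw (FundamentalGroupoid.fromPath
        (Path.Homotopic.Quotient.mk (γ.subpath (t 0) (t n)))) ∈ (edgePaths hs).arrows _ _ := by
    intro n
    induction n with
    | zero =>
      intro v w hv hw
      refine starConj_mem_edgePaths_of_subset hs htri (u := v) hv hw _ fun r => ?_
      rw [Path.subpath_self]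
      exact hv
    | succ n ih =>
      intro v w hv hw
      obtain ⟨u, hu⟩ := ht n
      have hmem : ∀ r, γ.subpath (t n) (t (n + 1)) r ∈ openStar I u := by
        intro r
        have := Set.mem_range_self (f := γ.subpath (t n) (t (n + 1))) r
        rw [Path.range_subpath_of_le γ _ _ (htm n.le_succ)] at this
        obtain ⟨s, hs, e⟩ := this
        rw [← e]
        exact hu hs
      have hn : γ (t n) ∈ openStar I u := hu ⟨le_rfl, htm n.le_succ⟩
      have e : FundamentalGroupoid.fromPath
          (Path.Homotopic.Quotient.mk (γ.subpath (t 0) (t (n + 1)))) =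
          FundamentalGroupoid.fromPath (Path.Homotopic.Quotient.mk (γ.subpath (t 0) (t n))) ≫
            FundamentalGroupoid.fromPath
              (Path.Homotopic.Quotient.mk (γ.subpath (t n) (t (n + 1)))) :=
        ((FundamentalGroupoid.fromPath_eq_iff_homotopic _ _).2
          ⟨Path.Homotopy.subpathTransSubpath γ (t 0) (t n) (t (n + 1))⟩).symm
      rw [e, starConj_comp hs htri hv hn hw]
      exact (edgePaths hs).mul (ih v u hv hn)
        (starConj_mem_edgePaths_of_subset hs htri hn hw _ hmem)
  -- The endpoints of the full subpath are `γ 0` and `γ 1`, equal to `x` and `y` only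
  -- propositionally.
  have cast_key : ∀ (a b : unitInterval) (x' y' : ClassifyingSpace I) (hx : x' ∈ openStar I v)
      (hy : y' ∈ openStar I w) (δ : Path x' y') (ha : γ a = x') (hb : γ b = y')
      (hδ : γ.subpath a b = δ.cast ha hb) (ha' : γ a ∈ openStar I v) (hb' : γ b ∈ openStar I w),
      starConj hs htri ha' hb' (FundamentalGroupoid.fromPath
        (Path.Homotopic.Quotient.mk (γ.subpath a b))) ∈ (edgePaths hs).arrows _ _ →
      starConj hs htri hx hy (FundamentalGroupoid.fromPath
        (Path.Homotopic.Quotient.mk δ)) ∈ (edgePaths hs).arrows _ _ := by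
    rintro a b _ _ hx hy δ rfl rfl hδ ha' hb' h
    rw [hδ] at h
    exact h
  have h1 : t m = 1 := hm m le_rfl
  refine cast_key 0 1 x y hx hy γ γ.source γ.target γ.subpath_zero_one
    (γ.source.symm ▸ hx) (γ.target.symm ▸ hy) ?_
  have := key m v w
  rw [ht0, h1] at this
  exact this _ _

theorem edgeFunctor_mapEnd_surjective (hs : ShortPathsNonzero I)
    (htri : ∀ (x : Q) (p : Quiver.Path x x), p.length = 0) (v : Q) :
    Function.Surjective
      ((edgeFunctor hs).mapEnd ((Quiver.FreeGroupoid.of Q).obj v)) := by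
  intro γ
  have hv := (vertexPoint_mem_openStar hs (v := v)).2 rfl
  have key : ∀ δ : FundamentalGroupoid.mk (vertexPoint hs v) ⟶
      FundamentalGroupoid.mk (vertexPoint hs v), δ ∈ (edgePaths hs).arrows _ _ := by
    intro δ
    -- Conjugating beforehand cancels the star paths at the vertex, so they need not be shown
    -- trivial.
    have h := starConj_mem_edgePaths hs htri hv hv
      (starHom hs htri hv ≫ δ ≫ Groupoid.inv (starHom hs htri hv))
    rwa [show starConj hs htri hv hv (starHom hs htri hv ≫ δ ≫
      Groupoid.inv (starHom hs htri hv)) = δ by simp [starConj]] at h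
  obtain ⟨a, b, g, ha, hb, hg⟩ :=
    (Subgroupoid.mem_im_iff _ (edgeFunctor_obj_injective hs) _).1 (key γ)
  obtain rfl : a = (Quiver.FreeGroupoid.of Q).obj v := edgeFunctor_obj_injective hs ha
  obtain rfl : b = (Quiver.FreeGroupoid.of Q).obj v := edgeFunctor_obj_injective hs hb
  refine ⟨g, ?_⟩
  rw [hg]
  exact ((Category.id_comp _).trans (Category.comp_id _)).symm

end Surjectivity

end

noncomputable section

section Covering

variable {k : Type w} {Q : Type u} [Field k] [Quiver.{v} Q] {I : TwoSidedIdeal (PathAlgebra k Q)}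
  {G : Type*} [Group G]

/-! ### The covering of the classifying space given by a functor to a group -/

/-- The value of a functor to a group on the path from the first vertex of a cell to the vertex
`i`. -/
def Cell.label (P : NatHomotopyCategory I ⥤ SingleObj G) {n : ℕ} (c : Cell I n)
    (i : Fin (n + 1)) : G :=
  P.map (c.1.map (homOfLE (Fin.zero_le i)))

theorem Cell.label_zero (P : NatHomotopyCategory I ⥤ SingleObj G) {n : ℕ} (c : Cell I n) :
    c.label P 0 = 1 := by
  have h : c.1.map (homOfLE (Fin.zero_le (0 : Fin (n + 1)))) = 𝟙 _ := c.1.map_id _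
  rw [Cell.label, h, CategoryTheory.Functor.map_id]
  rfl

/-- Omitting vertex `0` changes the base vertex of the labels, hence the correction factor. Only the
quotients of labels are intrinsic. -/
theorem Cell.label_face (P : NatHomotopyCategory I ⥤ SingleObj G) {n : ℕ} (c : Cell I (n + 1))
    (a : Fin (n + 2)) (i : Fin (n + 1)) :
    (c.face a).label P i * c.label P (a.succAbove 0) = c.label P (a.succAbove i) := by
  have h : c.1.map (homOfLE (Fin.zero_le (a.succAbove i))) =
      c.1.map (homOfLE (Fin.zero_le (a.succAbove 0))) ≫ (c.face a).1.map (homOfLE (Fin.zero_le i)) :=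
    c.1.map_comp (homOfLE (Fin.zero_le (a.succAbove 0)))
      (homOfLE ((Fin.strictMono_succAbove a).monotone (Fin.zero_le i)))
  exact ((congrArg P.map h).trans (P.map_comp _ _)).symm

/-- At a point of the open stars of `v` and `w`, the value of a functor to a group on the
edge from `v` to `w`. -/
def CellSimplices.Transition (P : NatHomotopyCategory I ⥤ SingleObj G) (v w : Q) (g : G)
    (z : CellSimplices I) : Prop :=
  ∃ i j, Cell.vert z.1.2 i = v ∧ Cell.vert z.1.2 j = w ∧ 0 < z.2 i ∧ 0 < z.2 j ∧
    Cell.label P z.1.2 j * (Cell.label P z.1.2 i)⁻¹ = g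

theorem CellSimplices.Transition.glue_iff (P : NatHomotopyCategory I ⥤ SingleObj G) (v w : Q)
    (g : G) {z z' : CellSimplices I} (h : Glue I z z') :
    Transition P v w g z ↔ Transition P v w g z' := by
  obtain ⟨c, a, t⟩ := h
  have hl : ∀ i j, c.label P (a.succAbove j) * (c.label P (a.succAbove i))⁻¹ =
      (c.face a).label P j * ((c.face a).label P i)⁻¹ := by
    intro i j
    rw [← c.label_face P a i, ← c.label_face P a j]
    group
  constructor
  · rintro ⟨i, j, hi, hj, hti, htj, hg⟩
    obtain hia | ⟨i, rfl⟩ := Fin.eq_self_or_eq_succAbove a i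
    · refine absurd ?_ hti.ne'
      rw [hia]
      exact stdSimplex.map_succAbove_apply_self _ t
    obtain hja | ⟨j, rfl⟩ := Fin.eq_self_or_eq_succAbove a j
    · refine absurd ?_ htj.ne'
      rw [hja]
      exact stdSimplex.map_succAbove_apply_self _ t
    exact ⟨i, j, hi, hj, (stdSimplex.map_succAbove_apply a t i) ▸ hti,
      (stdSimplex.map_succAbove_apply a t j) ▸ htj, (hl i j).symm.trans hg⟩
  · rintro ⟨i, j, hi, hj, hti, htj, hg⟩
    exact ⟨a.succAbove i, a.succAbove j, hi, hj, (stdSimplex.map_succAbove_apply a t i).symm ▸ hti,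
      (stdSimplex.map_succAbove_apply a t j).symm ▸ htj, (hl i j).trans hg⟩

/-- The set of points of the open stars of `v` and `w` where the transition from `v` to `w` is
`g`. -/
def transitionSet (P : NatHomotopyCategory I ⥤ SingleObj G) (v w : Q) (g : G) :
    Set (ClassifyingSpace I) :=
  {x | Quot.lift (CellSimplices.Transition P v w g)
    (fun _ _ h => propext (CellSimplices.Transition.glue_iff P v w g h)) x}

theorem Cell.point_mem_transitionSet (P : NatHomotopyCategory I ⥤ SingleObj G) {v w : Q} {g : G}
    {n : ℕ} {c : Cell I n} {t : stdSimplex ℝ (Fin (n + 1))} :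
    c.point t ∈ transitionSet P v w g ↔ ∃ i j, c.vert i = v ∧ c.vert j = w ∧ 0 < t i ∧ 0 < t j ∧
      c.label P j * (c.label P i)⁻¹ = g := Iff.rfl

theorem isOpen_transitionSet (P : NatHomotopyCategory I ⥤ SingleObj G) (v w : Q) (g : G) :
    IsOpen (transitionSet P v w g) := by
  rw [ClassifyingSpace.isOpen_iff]
  intro n c
  have : c.point ⁻¹' transitionSet P v w g = ⋃ i, ⋃ j, ⋃ (_ : c.vert i = v ∧ c.vert j = w ∧
      c.label P j * (c.label P i)⁻¹ = g), ({t | 0 < t i} ∩ {t | 0 < t j}) := by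
    ext t
    simp only [Set.mem_preimage, Cell.point_mem_transitionSet, Set.mem_iUnion, Set.mem_inter_iff,
      Set.mem_ofPred_eq, exists_prop]
    refine exists_congr fun i => exists_congr fun j => ?_
    tauto
  rw [this]
  exact isOpen_iUnion fun i => isOpen_iUnion fun j => isOpen_iUnion fun _ =>
    (isOpen_lt continuous_const (stdSimplex.continuous_apply i)).inter
      (isOpen_lt continuous_const (stdSimplex.continuous_apply j))

open Classical in
/-- The transition function between the open stars of `v` and `w`. -/
def transition (P : NatHomotopyCategory I ⥤ SingleObj G) (v w : Q) (x : ClassifyingSpace I) : G :=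
  if h : ∃ g, x ∈ transitionSet P v w g then h.choose else 1

theorem transition_point (htri : ∀ (x : Q) (p : Quiver.Path x x), p.length = 0)
    (P : NatHomotopyCategory I ⥤ SingleObj G)
    {n : ℕ} (c : Cell I n) {t : stdSimplex ℝ (Fin (n + 1))} {i j : Fin (n + 1)}
    (hi : 0 < t i) (hj : 0 < t j) :
    transition P (c.vert i) (c.vert j) (c.point t) = c.label P j * (c.label P i)⁻¹ := by
  have h : ∃ g, c.point t ∈ transitionSet P (c.vert i) (c.vert j) g :=
    ⟨_, (Cell.point_mem_transitionSet P).2 ⟨i, j, rfl, rfl, hi, hj, rfl⟩⟩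
  refine (dif_pos h).trans ?_
  obtain ⟨i', j', hi', hj', -, -, hg⟩ := (Cell.point_mem_transitionSet P).1 h.choose_spec
  rw [← hg, c.vert_injective htri hi', c.vert_injective htri hj']

/-- Transition values are constant on the open sets `transitionSet`; with a discrete fibre this
gives continuous coordinate changes. -/
theorem eventually_transition_eq (htri : ∀ (x : Q) (p : Quiver.Path x x), p.length = 0)
    (P : NatHomotopyCategory I ⥤ SingleObj G)
    {v w : Q} {x : ClassifyingSpace I} (hv : x ∈ openStar I v) (hw : x ∈ openStar I w) :
    ∀ᶠ y in nhds x, transition P v w y = transition P v w x := by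
  obtain ⟨n, c, t, rfl⟩ := x.exists_point
  obtain ⟨i, rfl, hi⟩ := Cell.point_mem_openStar.1 hv
  obtain ⟨j, rfl, hj⟩ := Cell.point_mem_openStar.1 hw
  have hmem : c.point t ∈ transitionSet P (c.vert i) (c.vert j)
      (c.label P j * (c.label P i)⁻¹) :=
    (Cell.point_mem_transitionSet P).2 ⟨i, j, rfl, rfl, hi, hj, rfl⟩
  filter_upwards [(isOpen_transitionSet P _ _ _).mem_nhds hmem] with y hy
  rw [transition_point htri P c hi hj]
  obtain ⟨n', c', t', rfl⟩ := y.exists_point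
  obtain ⟨i', j', hi', hj', hti', htj', hg⟩ := (Cell.point_mem_transitionSet P).1 hy
  rw [← hi', ← hj', transition_point htri P c' hti' htj', hg]

variable [TopologicalSpace G] [DiscreteTopology G]

/-- The bundle on the classifying space with fibre `G` given by a functor to `G`. -/
def coveringCore (htri : ∀ (x : Q) (p : Quiver.Path x x), p.length = 0)
    (P : NatHomotopyCategory I ⥤ SingleObj G) :
    FiberBundleCore Q (ClassifyingSpace I) G where
  baseSet v := openStar I v
  isOpen_baseSet := isOpen_openStar
  indexAt x := (exists_mem_openStar x).choose
  mem_baseSet_at x := (exists_mem_openStar x).choose_spec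
  coordChange v w x g := transition P v w x * g
  coordChange_self := by
    intro v x hx g
    obtain ⟨n, c, t, rfl⟩ := x.exists_point
    obtain ⟨i, rfl, hi⟩ := Cell.point_mem_openStar.1 hx
    rw [transition_point htri P c hi hi, mul_inv_cancel, one_mul]
  continuousOn_coordChange := by
    rintro v w ⟨x, g⟩ ⟨⟨hv, hw⟩, -⟩
    refine ContinuousAt.continuousWithinAt ?_
    have h : Continuous fun p : ClassifyingSpace I × G => transition P v w x * p.2 :=
      (continuous_of_discreteTopology (f := fun g : G => transition P v w x * g)).comp
        continuous_snd
    refine h.continuousAt.congr ?_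
    filter_upwards [continuousAt_fst.eventually (eventually_transition_eq htri P hv hw)] with p hp
    rw [hp]
  coordChange_comp := by
    rintro u v w x ⟨⟨hu, hv⟩, hw⟩ g
    obtain ⟨n, c, t, rfl⟩ := x.exists_point
    obtain ⟨i, rfl, hi⟩ := Cell.point_mem_openStar.1 hu
    obtain ⟨j, rfl, hj⟩ := Cell.point_mem_openStar.1 hv
    obtain ⟨l, rfl, hl⟩ := Cell.point_mem_openStar.1 hw
    rw [transition_point htri P c hi hj, transition_point htri P c hj hl,
      transition_point htri P c hi hl]
    group

theorem isCoveringMap_coveringCore (htri : ∀ (x : Q) (p : Quiver.Path x x), p.length = 0)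
    (P : NatHomotopyCategory I ⥤ SingleObj G) : IsCoveringMap (coveringCore htri P).proj :=
  FiberBundle.isCoveringMap (F := G)

/-- A vertex lies in no open star but its own, so fibre coordinates over vertices involve no choice.
-/
theorem coveringCore_indexAt_vertexPoint (hs : ShortPathsNonzero I)
    (htri : ∀ (x : Q) (p : Quiver.Path x x), p.length = 0)
    (P : NatHomotopyCategory I ⥤ SingleObj G) (v : Q) :
    (coveringCore htri P).indexAt (vertexPoint hs v) = v :=
  (vertexPoint_mem_openStar hs).1 ((coveringCore htri P).mem_baseSet_at (vertexPoint hs v))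

theorem coveringCore_exists_index (htri : ∀ (x : Q) (p : Quiver.Path x x), p.length = 0)
    (P : NatHomotopyCategory I ⥤ SingleObj G) {n : ℕ} (c : Cell I n)
    (t : stdSimplex ℝ (Fin (n + 1))) :
    ∃ i, c.vert i = (coveringCore htri P).indexAt (c.point t) ∧ 0 < t i :=
  Cell.point_mem_openStar.1 ((coveringCore htri P).mem_baseSet_at (c.point t))

/-- The flat section of the covering over a cell. -/
def flatSection (htri : ∀ (x : Q) (p : Quiver.Path x x), p.length = 0)
    (P : NatHomotopyCategory I ⥤ SingleObj G) {n : ℕ} (c : Cell I n) (g : G)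
    (t : stdSimplex ℝ (Fin (n + 1))) : (coveringCore htri P).TotalSpace :=
  ⟨c.point t, (c.label P (coveringCore_exists_index htri P c t).choose * g : G)⟩

/-- In the chart of a vertex `i` of the cell, the section has the constant fibre coordinate `c.label
P i * g`. -/
theorem continuous_flatSection (htri : ∀ (x : Q) (p : Quiver.Path x x), p.length = 0)
    (P : NatHomotopyCategory I ⥤ SingleObj G) {n : ℕ} (c : Cell I n) (g : G) :
    Continuous (flatSection htri P c g) := by
  refine continuous_iff_continuousAt.2 fun t => ?_
  let Z := coveringCore htri P
  obtain ⟨i, hi, hti⟩ := coveringCore_exists_index htri P c t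
  refine ((Z.localTrivAt (c.point t)).toOpenPartialHomeomorph.continuousAt_iff_continuousAt_comp_left
    ?_).2 ?_
  · exact c.continuous_point.continuousAt
      ((Z.isOpen_baseSet _).mem_nhds (Z.mem_baseSet_at (c.point t)))
  · have hc : ContinuousAt (fun s => (c.point s, c.label P i * g)) t :=
      (c.continuous_point.prodMk continuous_const).continuousAt
    refine hc.congr ?_
    have hn : ∀ᶠ s : stdSimplex ℝ (Fin (n + 1)) in nhds t, 0 < s i :=
      (isOpen_lt continuous_const (stdSimplex.continuous_apply i)).mem_nhds hti
    filter_upwards [hn] with s hsi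
    obtain ⟨hj, htj⟩ := (coveringCore_exists_index htri P c s).choose_spec
    set j := (coveringCore_exists_index htri P c s).choose
    refine Prod.ext rfl ?_
    change c.label P i * g = transition P ((coveringCore htri P).indexAt (c.point s))
      ((coveringCore htri P).indexAt (c.point t)) (c.point s) * (c.label P j * g)
    rw [← hi, ← hj, transition_point htri P c htj hsi]
    group

theorem flatSection_vertex (hs : ShortPathsNonzero I)
    (htri : ∀ (x : Q) (p : Quiver.Path x x), p.length = 0)
    (P : NatHomotopyCategory I ⥤ SingleObj G) {n : ℕ} (c : Cell I n) (g : G) (i : Fin (n + 1)) :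
    flatSection htri P c g (stdSimplex.vertex i) =
      ⟨vertexPoint hs (c.vert i), (c.label P i * g : G)⟩ := by
  have h := (coveringCore_exists_index htri P c (stdSimplex.vertex i)).choose_spec.1
  have := c.vert_injective htri (h.trans ((congrArg _ (c.point_vertex hs i)).trans
    (coveringCore_indexAt_vertexPoint hs htri P (c.vert i))))
  refine Bundle.TotalSpace.ext (c.point_vertex hs i) (heq_of_eq ?_)
  exact congrArg (fun j => c.label P j * g) this

/-- The flat section over the cell lifts the edge. -/
theorem monodromy_edge (hs : ShortPathsNonzero I)
    (htri : ∀ (x : Q) (p : Quiver.Path x x), p.length = 0)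
    (P : NatHomotopyCategory I ⥤ SingleObj G) {n : ℕ} (c : Cell I n) (g : G) (i j : Fin (n + 1)) :
    (isCoveringMap_coveringCore htri P).monodromy (c.edge hs i j)
        ⟨⟨vertexPoint hs (c.vert i), (c.label P i * g : G)⟩, rfl⟩ =
      ⟨⟨vertexPoint hs (c.vert j), (c.label P j * g : G)⟩, rfl⟩ := by
  let γ := (PathConnectedSpace.somePath (stdSimplex.vertex (S := ℝ) i)
    (stdSimplex.vertex (S := ℝ) j)).map (continuous_flatSection htri P c g)
  refine (isCoveringMap_coveringCore htri P).monodromy_eq_of_map_eq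
    (Path.Homotopic.Quotient.mk (γ.cast (flatSection_vertex hs htri P c g i).symm
      (flatSection_vertex hs htri P c g j).symm)) ?_
  have e : c.edge hs i j = Path.Homotopic.Quotient.cast
      (c.hom (stdSimplex.vertex i) (stdSimplex.vertex j)) (c.point_vertex hs i).symm (c.point_vertex hs j).symm :=
    FundamentalGroupoid.conj_eqToHom (p := c.hom (stdSimplex.vertex i) (stdSimplex.vertex j))
      (c.point_vertex hs i).symm (c.point_vertex hs j).symm
  rw [e]
  rfl

end Covering

end

noncomputable section

section Comparison

variable {k : Type w} {Q : Type u} [Field k] [Quiver.{v} Q] {I : TwoSidedIdeal (PathAlgebra k Q)}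

/-! ### Short paths and admissible ideals -/

variable (k Q) in
/-- The span of the paths of length at least `n`. -/
def longPaths (n : ℕ) : Submodule k (PathAlgebra k Q) :=
  Submodule.span k {a | ∃ (x y : Q) (p : Quiver.Path x y), n ≤ p.length ∧
    a = PathAlgebra.ofPath k p}

theorem mul_mem_longPaths {m n : ℕ} {a b : PathAlgebra k Q} (ha : a ∈ longPaths k Q m)
    (hb : b ∈ longPaths k Q n) : a * b ∈ longPaths k Q (m + n) := by
  induction ha using Submodule.span_induction with
  | zero => rw [zero_mul]; exact zero_mem _
  | add a a' _ _ h h' => rw [add_mul]; exact add_mem h h'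
  | smul c a _ h => rw [PathAlgebra.smul_mul]; exact Submodule.smul_mem _ _ h
  | mem a ha =>
    obtain ⟨x, y, p, hp, rfl⟩ := ha
    induction hb using Submodule.span_induction with
    | zero => rw [mul_zero]; exact zero_mem _
    | add b b' _ _ h h' => rw [mul_add]; exact add_mem h h'
    | smul c b _ h => rw [PathAlgebra.mul_smul]; exact Submodule.smul_mem _ _ h
    | mem b hb =>
      obtain ⟨z, t, q, hq, rfl⟩ := hb
      by_cases hyz : y = z
      · subst hyz
        rw [PathAlgebra.ofPath_mul_ofPath]
        exact Submodule.subset_span ⟨x, t, p.comp q, by rw [Quiver.Path.length_comp]; omega, rfl⟩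
      · rw [PathAlgebra.ofPath_mul_ofPath_of_ne _ _ hyz]
        exact zero_mem _

theorem mem_longPaths_zero (a : PathAlgebra k Q) : a ∈ longPaths k Q 0 := by
  induction a using PathAlgebra.induction with
  | zero => exact zero_mem _
  | add a b ha hb => exact add_mem ha hb
  | path c p => exact Submodule.smul_mem _ _ (Submodule.subset_span ⟨_, _, p, Nat.zero_le _, rfl⟩)

/-- The coordinate functional of `p` kills all longer paths but not `p`. -/
theorem ofPath_notMem_longPaths {n : ℕ} {x y : Q} (p : Quiver.Path x y) (hp : p.length < n) :
    PathAlgebra.ofPath k p ∉ longPaths k Q n := by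
  intro h
  have hle : longPaths k Q n ≤ LinearMap.ker ((PathAlgebra.basis k Q).coord ⟨x, y, p⟩) := by
    refine Submodule.span_le.2 ?_
    rintro _ ⟨z, t, q, hq, rfl⟩
    have hne : (⟨z, t, q⟩ : Σ x : Q, Σ y : Q, Quiver.Path x y) ≠ ⟨x, y, p⟩ := by
      intro e
      cases e
      omega
    simp [PathAlgebra.ofPath, hne]
  have := hle h
  simp [PathAlgebra.ofPath] at this

theorem arrowIdeal_le_longPaths [Fintype Q] {a : PathAlgebra k Q} (ha : a ∈ arrowIdeal k Q) :
    a ∈ longPaths k Q 1 := by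
  let J : TwoSidedIdeal (PathAlgebra k Q) := TwoSidedIdeal.mk' (longPaths k Q 1)
    (zero_mem _) (fun h h' => add_mem h h') (fun h => neg_mem h)
    (fun {a b} h => by
      have := mul_mem_longPaths (mem_longPaths_zero a) h
      rwa [Nat.zero_add] at this)
    (fun {a b} h => by
      have := mul_mem_longPaths h (mem_longPaths_zero b)
      rwa [Nat.add_zero] at this)
  have hJ : arrowIdeal k Q ≤ J := by
    rw [arrowIdeal]
    refine TwoSidedIdeal.span_le.2 ?_
    rintro _ ⟨x, y, α, rfl⟩
    exact (TwoSidedIdeal.mem_mk' ..).2 (Submodule.subset_span ⟨x, y, α.toPath, le_rfl, rfl⟩)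
  exact (TwoSidedIdeal.mem_mk' ..).1 (hJ ha)

/-- `I` lies in `F ^ 2`, which lies in the span of the paths of length at least two. -/
theorem IsAdmissible.shortPathsNonzero [Fintype Q] (hI : IsAdmissible I) :
    ShortPathsNonzero I := by
  intro x y p hp hpI
  obtain ⟨_, -, -, h⟩ := hI
  refine ofPath_notMem_longPaths (k := k) (n := 2) p (by omega) ?_
  let J : Ideal (PathAlgebra k Q) :=
    { carrier := longPaths k Q 2
      add_mem' := fun h h' => add_mem h h'
      zero_mem' := zero_mem (longPaths k Q 2)
      smul_mem' := fun a b hb => by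
        have := mul_mem_longPaths (mem_longPaths_zero a) hb
        rwa [Nat.zero_add] at this }
  have hF : (arrowIdeal k Q).asIdeal ^ 2 ≤ J := by
    rw [Submodule.pow_succ, Submodule.pow_one]
    exact Ideal.mul_le.2 fun a ha b hb => mul_mem_longPaths (m := 1) (n := 1)
      (arrowIdeal_le_longPaths (TwoSidedIdeal.mem_asIdeal.1 ha))
      (arrowIdeal_le_longPaths (TwoSidedIdeal.mem_asIdeal.1 hb))
  exact hF (h (TwoSidedIdeal.mem_asIdeal.2 hpI))

/-! ### The functor to the fundamental group of the bound quiver -/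

variable (Q) in
/-- The functor from the path category to the free groupoid. -/
def pathsToFreeGroupoid : Paths Q ⥤ Quiver.FreeGroupoid Q where
  obj x := (Quiver.FreeGroupoid.of Q).obj x
  map p := Walk.toFree (Q := Q) (Walk.ofPath (Q := Q) p)
  map_id _ := rfl
  map_comp p q :=
    (congrArg (Walk.toFree (Q := Q)) (Prefunctor.mapPath_comp (Quiver.Symmetrify.of (V := Q)) p q)).trans
      (Walk.toFree_comp _ _)

/-! ### Closing up morphisms of a groupoid to loops. -/

namespace CategoryTheory.Groupoid

variable {C : Type*} [Groupoid C] {c : C}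

/-- Closing up a morphism of a groupoid to a loop, by means of morphisms from the base point. -/
def loop (τ : ∀ x : C, c ⟶ x) {x y : C} (g : x ⟶ y) : End c := τ x ≫ g ≫ inv (τ y)

theorem loop_id (τ : ∀ x : C, c ⟶ x) (x : C) : loop τ (𝟙 x) = 1 := by
  rw [loop, Category.id_comp, comp_inv]
  rfl

/-- Multiplication in `End` reverses composition, as it does in `SingleObj`, so `closeUp` is
covariant. -/
theorem loop_comp (τ : ∀ x : C, c ⟶ x) {x y z : C} (g : x ⟶ y) (h : y ⟶ z) :
    loop τ (g ≫ h) = loop τ h * loop τ g := by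
  rw [End.mul_def]
  simp [loop]

/-- The functor to a quotient of a vertex group given by morphisms from the base point. -/
def closeUp (N : Subgroup (End c)) [N.Normal] (τ : ∀ x : C, c ⟶ x) :
    C ⥤ SingleObj (End c ⧸ N) where
  obj _ := SingleObj.star _
  map g := QuotientGroup.mk (s := N) (loop τ g)
  map_id x := congrArg _ (loop_id τ x)
  map_comp g h := congrArg _ (loop_comp τ g h)

/-- The hypothesis has the shape of the generators of `homotopySubgroup`, with `τ x` as the
connecting walk. -/
theorem closeUp_map_eq (N : Subgroup (End c)) [N.Normal] (τ : ∀ x : C, c ⟶ x) {x y : C}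
    {g h : x ⟶ y} (hN : (((τ x ≫ h) ≫ inv g) ≫ inv (τ x) : End c) ∈ N) :
    (closeUp N τ).map g = (closeUp N τ).map h := by
  refine QuotientGroup.eq.2 ?_
  have e : (loop τ g)⁻¹ * loop τ h = ((τ x ≫ h) ≫ inv g) ≫ inv (τ x) := by
    rw [inv_mul_eq_iff_eq_mul]
    refine Eq.trans ?_ (End.mul_def _ _).symm
    simp [loop]
  exact e ▸ hN

/-- Closing up a loop conjugates it by `τ c`, which need not be trivial; normality of `N` absorbs
this. -/
theorem closeUp_map_eq_one_iff (N : Subgroup (End c)) [N.Normal] (τ : ∀ x : C, c ⟶ x)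
    (g : End c) :
    (closeUp N τ).map (X := c) (Y := c) g = (1 : End c ⧸ N) ↔ g ∈ N := by
  refine (QuotientGroup.eq_one_iff (N := N) _).trans ?_
  let t : End c := τ c
  have e : loop τ (x := c) (y := c) g = t⁻¹ * (g * t) := by
    rw [eq_inv_mul_iff_mul_eq, End.mul_def, End.mul_def]
    simp [loop, t]
  rw [e, (inferInstance : N.Normal).mem_comm_iff, mul_assoc, mul_inv_cancel, mul_one]

end CategoryTheory.Groupoid

/-- The functor to the fundamental group of a bound quiver, given by morphisms from the base point,
on natural homotopy classes of paths. -/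
def natCloseUp (I : TwoSidedIdeal (PathAlgebra k Q)) {x₀ : Q}
    (τ : ∀ x : Quiver.FreeGroupoid Q, (Quiver.FreeGroupoid.of Q).obj x₀ ⟶ x) :
    NatHomotopyCategory I ⥤ SingleObj (QuiverFundamentalGroup I x₀) :=
  CategoryTheory.Quotient.lift _ (pathsToFreeGroupoid Q ⋙
    Groupoid.closeUp (homotopySubgroup I x₀) τ) fun x y p q h => by
      refine Groupoid.closeUp_map_eq _ τ (Subgroup.subset_normalClosure ?_)
      obtain ⟨t, ht⟩ := Walk.toFree_surjective (τ ((Quiver.FreeGroupoid.of Q).obj x))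
      refine ⟨x, y, t, p, q, .minimal h, ?_⟩
      change ((τ ((Quiver.FreeGroupoid.of Q).obj x) ≫ _) ≫ _) ≫ Groupoid.inv
        (τ ((Quiver.FreeGroupoid.of Q).obj x)) = _
      rw [← ht]
      rfl

/-! ### Monodromy of edge paths and the kernel. -/

variable {G : Type*} [Group G] [TopologicalSpace G] [DiscreteTopology G]

/-- The monodromy of the class of an edge path is the left multiplication with the value of a
functor. -/
def HasMonodromy (hs : ShortPathsNonzero I)
    (htri : ∀ (x : Q) (p : Quiver.Path x x), p.length = 0)
    (P : NatHomotopyCategory I ⥤ SingleObj G) (R : Quiver.FreeGroupoid Q ⥤ SingleObj G) {x y : Q}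
    (γ : (Quiver.FreeGroupoid.of Q).obj x ⟶ (Quiver.FreeGroupoid.of Q).obj y) : Prop :=
  ∀ g : G, (isCoveringMap_coveringCore htri P).monodromy ((edgeFunctor hs).map γ)
    ⟨⟨vertexPoint hs x, g⟩, rfl⟩ = ⟨⟨vertexPoint hs y, ((R.map γ : G) * g : G)⟩, rfl⟩

namespace HasMonodromy

variable {hs : ShortPathsNonzero I} {htri : ∀ (x : Q) (p : Quiver.Path x x), p.length = 0}
  {P : NatHomotopyCategory I ⥤ SingleObj G} {R : Quiver.FreeGroupoid Q ⥤ SingleObj G}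

theorem id (x : Q) : HasMonodromy hs htri P R (𝟙 ((Quiver.FreeGroupoid.of Q).obj x)) := by
  intro g
  have h : (R.map (𝟙 ((Quiver.FreeGroupoid.of Q).obj x)) : G) = 1 := R.map_id _
  rw [h, one_mul]
  exact (congrArg (fun γ => (isCoveringMap_coveringCore htri P).monodromy γ _)
    ((edgeFunctor hs).map_id _)).trans
    (congrFun (isCoveringMap_coveringCore htri P).monodromy_refl _)

theorem comp {x y z : Q}
    {γ : (Quiver.FreeGroupoid.of Q).obj x ⟶ (Quiver.FreeGroupoid.of Q).obj y}
    {δ : (Quiver.FreeGroupoid.of Q).obj y ⟶ (Quiver.FreeGroupoid.of Q).obj z}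
    (hγ : HasMonodromy hs htri P R γ) (hδ : HasMonodromy hs htri P R δ) :
    HasMonodromy hs htri P R (γ ≫ δ) := by
  intro g
  have h : (R.map (γ ≫ δ) : G) = (R.map δ : G) * (R.map γ : G) := R.map_comp _ _
  rw [h, mul_assoc, ← hδ, ← hγ]
  exact (congrArg (fun γ => (isCoveringMap_coveringCore htri P).monodromy γ _)
    ((edgeFunctor hs).map_comp γ δ)).trans
    ((isCoveringMap_coveringCore htri P).monodromy_trans_apply _ _ _)

theorem inv {x y : Q}
    {γ : (Quiver.FreeGroupoid.of Q).obj x ⟶ (Quiver.FreeGroupoid.of Q).obj y}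
    (hγ : HasMonodromy hs htri P R γ) : HasMonodromy hs htri P R (Groupoid.inv γ) := by
  intro g
  -- This fibre point is chosen so that the monodromy of `γ` carries it to `g`.
  have h := hγ ((R.map (Groupoid.inv γ) : G) * g)
  have e : (R.map γ : G) * ((R.map (Groupoid.inv γ) : G) * g) = g := by
    have h' := R.map_comp (Groupoid.inv γ) γ
    rw [Groupoid.inv_comp, CategoryTheory.Functor.map_id] at h'
    rw [← mul_assoc]
    exact (congrArg (· * g) h'.symm).trans (one_mul g)
  rw [e] at h
  rw [← h]
  refine ((isCoveringMap_coveringCore htri P).monodromy_trans_apply _ _ _).symm.trans ?_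
  have h' : (edgeFunctor hs).map γ ≫ (edgeFunctor hs).map (Groupoid.inv γ) = 𝟙 _ := by
    rw [← Functor.map_comp, Groupoid.comp_inv, CategoryTheory.Functor.map_id]
  exact (congrArg (fun γ => (isCoveringMap_coveringCore htri P).monodromy γ _) h').trans
    (congrFun (isCoveringMap_coveringCore htri P).monodromy_refl _)

theorem of_arrow {x y : Q} (α : x ⟶ y)
    (h : (P.map ((natClass I).map (X := (x : Paths Q)) (Y := (y : Paths Q)) α.toPath) : G) =
      (R.map ((Quiver.FreeGroupoid.of Q).map α) : G)) :
    HasMonodromy hs htri P R ((Quiver.FreeGroupoid.of Q).map α) := by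
  intro g
  rw [edgeFunctor_map_of, ← h]
  have := monodromy_edge hs htri P (Cell.ofSequence (I := I) (n := 1) _ (isNonzeroSequence_mk₁
    (x := x) (y := y) (p := α.toPath) one_ne_zero (hs x y α.toPath le_rfl))) g 0 1
  rw [Cell.label_zero, one_mul] at this
  exact this

theorem of_walk (h : ∀ {x y : Q} (α : x ⟶ y),
      (P.map ((natClass I).map (X := (x : Paths Q)) (Y := (y : Paths Q)) α.toPath) : G) =
        (R.map ((Quiver.FreeGroupoid.of Q).map α) : G))
    {x y : Q} (p : Walk x y) : HasMonodromy hs htri P R p.toFree := by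
  induction p with
  | nil => exact HasMonodromy.id x
  | cons p e ih =>
    obtain α | α := e
    · exact ih.comp (of_arrow α (h α))
    · exact ih.comp (of_arrow α (h α)).inv

end HasMonodromy

/-- One inclusion reads off the class of a loop from its monodromy at the fibre point `1`; for the
other, each generator maps to the identity because homotopic walks have equal images. -/
theorem edgeFunctor_mapEnd_ker (hs : ShortPathsNonzero I)
    (htri : ∀ (x : Q) (p : Quiver.Path x x), p.length = 0)
    (hconn : ∀ x y : Q, Nonempty (Walk x y)) (x₀ : Q) :
    ((edgeFunctor hs).mapEnd ((Quiver.FreeGroupoid.of Q).obj x₀)).ker =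
      homotopySubgroup I x₀ := by
  apply le_antisymm
  · intro γ hγ
    let G := QuiverFundamentalGroup I x₀
    let _ : TopologicalSpace G := ⊥
    have : DiscreteTopology G := ⟨rfl⟩
    let τ : ∀ x : Quiver.FreeGroupoid Q, (Quiver.FreeGroupoid.of Q).obj x₀ ⟶ x :=
      fun x => (hconn x₀ x.as).some.toFree
    let R := Groupoid.closeUp (homotopySubgroup I x₀) τ
    obtain ⟨p, rfl⟩ := Walk.toFree_surjective γ
    have h := HasMonodromy.of_walk (hs := hs) (htri := htri) (P := natCloseUp I τ) (R := R)
      (fun α => rfl) p 1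
    have h' : (edgeFunctor hs).map p.toFree = 𝟙 _ := hγ
    have h'' := (congrArg (fun γ => (isCoveringMap_coveringCore htri (natCloseUp I τ)).monodromy γ
      ⟨⟨vertexPoint hs x₀, (1 : G)⟩, rfl⟩) h').trans
      (congrFun (isCoveringMap_coveringCore htri (natCloseUp I τ)).monodromy_refl _)
    have e := h.symm.trans h''
    have e' := eq_of_heq (Bundle.TotalSpace.mk.inj (congrArg Subtype.val e)).2
    exact (Groupoid.closeUp_map_eq_one_iff _ τ _).1 ((mul_one (M := G) _).symm.trans e')
  · refine Subgroup.normalClosure_le_normal ?_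
    rintro _ ⟨x, y, w, p, q, h, rfl⟩
    change (edgeFunctor hs).map (((w.toFree ≫ (Walk.ofPath q).toFree) ≫
      Groupoid.inv (Walk.ofPath p).toFree) ≫ Groupoid.inv w.toFree) = 𝟙 _
    have e := edgeFunctor_map_eq_of_homotopic htri hs h
    simp only [Functor.map_comp, ← e]
    simp

end Comparison

end

/-- For a bound quiver `(Q, I)` with `Q` finite, connected and without oriented cycles, the
fundamental group of the classifying space `B(Q, I)` is isomorphic to `π₁(Q, I)`, for every choice
of base points. -/
theorem theorem3p3 {k : Type w} [Field k] {Q : Type u} [Quiver.{v} Q] [Fintype Q]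
    [∀ x y : Q, Finite (x ⟶ y)]
    (hconn : ∀ x y : Q, Nonempty (Walk x y))
    (htri : ∀ (x : Q) (p : Quiver.Path x x), p.length = 0)
    (I : TwoSidedIdeal (PathAlgebra k Q)) (hI : IsAdmissible I)
    (x₀ : Q) (b : ClassifyingSpace I) :
    Nonempty (FundamentalGroup (ClassifyingSpace I) b ≃* QuiverFundamentalGroup I x₀) := by
  have hs := hI.shortPathsNonzero
  let Φ := (edgeFunctor hs).mapEnd ((Quiver.FreeGroupoid.of Q).obj x₀)
  have hΦ : Function.Surjective Φ := edgeFunctor_mapEnd_surjective hs htri x₀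
  have hker : Φ.ker = homotopySubgroup I x₀ := edgeFunctor_mapEnd_ker hs htri hconn x₀
  obtain ⟨v, hv⟩ := exists_mem_openStar b
  obtain ⟨p⟩ := hconn v x₀
  -- The base point `b` is joined to a vertex inside an open star, then to `x₀` by an edge path.
  let γ : FundamentalGroupoid.mk b ⟶ FundamentalGroupoid.mk (vertexPoint hs x₀) :=
    starHom hs htri hv ≫ (edgeFunctor hs).map (Walk.toFree p)
  have e₁ : FundamentalGroup (ClassifyingSpace I) b ≃*
      FundamentalGroup (ClassifyingSpace I) (vertexPoint hs x₀) :=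
    ((Groupoid.isoEquivHom _ _).symm γ).conj
  have e₂ : QuiverFundamentalGroup I x₀ ≃*
      FundamentalGroup (ClassifyingSpace I) (vertexPoint hs x₀) :=
    (QuotientGroup.quotientMulEquivOfEq hker.symm).trans
      (QuotientGroup.quotientKerEquivOfSurjective Φ hΦ)
  exact ⟨e₁.trans e₂.symm⟩
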